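/- Let $\mathbb{P}$ be the space of complex polynomials. A Jacobi-type pencil is a tuple $\Theta=(J_3,J_5,\alpha,\beta)$, where $\alpha>0$, $\beta\in\mathbb{R}$, $J_3$ is a semi-infinite real symmetric tridiagonal matrix with positive subdiagonal (a Jacobi matrix), and $J_5$ is a semi-infinite real symmetric five-diagonal matrix with positive entries on the second subdiagonal. Its associated polynomials $(p_n)_{n\ge 0}$ are defined by $p_0(\lambda)=1$, $p_1(\lambda)=\alpha\lambda+\beta$ and $(J_5-\lambda J_3)(p_0(\lambda),p_1(\lambda),\dots)^{T}=0$. A sesquilinear functional $S$ on $\mathbb{P}$ (linear in the first, conjugate-linear in the second argument) is the spectral function of $\Theta$ if $S(p_n,p_m)=\delta_{n,m}$ for all $n,m\ge 0$. Let $S$ be a sesquilinear functional on $\mathbb{P}$ with $\overline{S(u,v)}=S(v,u)$ and $S(u,u)\ge 0$ for all $u,v\in\mathbb{P}$. Then $S$ is the spectral function of some Jacobi-type pencil if and only if $$S(u,v)=\int_{\mathbb{R}} u(\mathcal{A})(1)\,\overline{v(\mathcal{A})(1)}\,d\sigma,\qquad u,v\in\mathbb{P}, \qquad (*)$$ for some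 Borel probability measure $\sigma$ on $\mathbb{R}$ with all power moments finite and $\int_{\mathbb{R}}|g|^2\,d\sigma>0$ for every non-zero $g\in\mathbb{P}$, and some linear operator $\mathcal{A}$ in $L^2_\sigma$ such that (i) the domain of $\mathcal{A}$ is the set $\mathcal{P}$ of classes of polynomials in $L^2_\sigma$; (ii) for each $k\ge 0$, $\mathcal{A}x^k=\xi_{k,k+1}x^{k+1}+\sum_{j=0}^{k}\xi_{k,j}x^j$ with $\xi_{k,k+1}>0$ and $\xi_{k,j}\in\mathbb{R}$ for $0\le j\le k$; (iii) $\mathcal{A}\Lambda_0$ is symmetric, i.e. $(\mathcal{A}\Lambda_0 f,g)_{L^2_\sigma}=(f,\mathcal{A}\Lambda_0 g)_{L^2_\sigma}$ for $f,g\in\mathcal{P}$, where $\Lambda_0$ is multiplication by the independent variable on $\mathcal{P}$. Moreover, whenever $\sigma$ and $\mathcal{A}$ are as above and $(*)$ holds, $S$ is the spectral function of the following Jacobi-type pencil $(J_3,J_5,\alpha,\beta)$. Let $(r_n)_{n\ge 0}$ be the orthonormal polynomials of $\sigma$ with positive leading coefficients and $s_k=\int x^k\,d\sigma$. Then $J_3$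 is the Jacobi matrix of $\sigma$, i.e. $J_3(r_0(\lambda),r_1(\lambda),\dots)^{T}=\lambda(r_0(\lambda),r_1(\lambda),\dots)^{T}$; the entries of $J_5$ are $(J_5)_{m,n}=(\mathcal{A}\Lambda_0 r_n,r_m)_{L^2_\sigma}$, $m,n\ge 0$; and $$\alpha=\frac{1}{\xi_{0,1}\sqrt{s_2-s_1^2}},\qquad \beta=-\frac{\xi_{0,1}s_1+\xi_{0,0}}{\xi_{0,1}\sqrt{s_2-s_1^2}}.$$ -/

import Mathlib

noncomputable section

open MeasureTheory Polynomial ComplexConjugate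

namespace JacobiPencil

/-- A Jacobi-type pencil `(J₃, J₅, α, β)`: `J₃` is a semi-infinite Jacobi matrix, `J₅` is a
semi-infinite real symmetric five-diagonal matrix with positive second subdiagonal,
`α > 0` and `β` is real. -/
structure Pencil where
  J₃ : Matrix ℕ ℕ ℝ
  J₅ : Matrix ℕ ℕ ℝ
  α : ℝ
  β : ℝ
  J₃_symm : J₃.IsSymm
  J₃_tridiagonal : ∀ m n, n + 1 < m → J₃ m n = 0
  J₃_pos : ∀ n, 0 < J₃ (n + 1) n
  J₅_symm : J₅.IsSymm
  J₅_fiveDiagonal : ∀ m n, n + 2 < m → J₅ m n = 0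
  J₅_pos : ∀ n, 0 < J₅ (n + 2) n
  α_pos : 0 < α

/-- `p` is the system of polynomials associated to the pencil:
`p₀ = 1`, `p₁ = α λ + β` and `(J₅ - λ J₃) p⃗(λ) = 0`.
The entries of row `n` of `J₃` and `J₅` vanish beyond column `n + 2`, so that the product of the
row with the infinite column is the sum below. -/
structure Pencil.IsAssociated (Θ : Pencil) (p : ℕ → ℂ[X]) : Prop where
  zero : p 0 = 1
  one : p 1 = C (Θ.α : ℂ) * X + C (Θ.β : ℂ)
  row : ∀ n, ∑ m ∈ Finset.range (n + 3),
    (C (Θ.J₅ n m : ℂ) - X * C (Θ.J₃ n m : ℂ)) * p m = 0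

/-- The sesquilinear functional `S` (linear in the first argument, conjugate-linear in the second)
is the spectral function of the pencil `Θ`: `S(pₙ, pₘ) = δₙₘ` for the associated polynomials. -/
def Pencil.IsSpectralFunction (Θ : Pencil) (S : ℂ[X] →ₗ[ℂ] ℂ[X] →ₗ⋆[ℂ] ℂ) : Prop :=
  ∃ p : ℕ → ℂ[X], Θ.IsAssociated p ∧ ∀ n m, S (p n) (p m) = if n = m then 1 else 0

/-- A probability measure on the Borel sets of `ℝ` with all power moments finite, such that
`∫ |g|² dσ > 0` for every non-zero complex polynomial `g`. -/
structure Admissible (σ : Measure ℝ) : Prop where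
  prob : IsProbabilityMeasure σ
  moments : ∀ n : ℕ, Integrable (fun x : ℝ => x ^ n) σ
  pos : ∀ g : ℂ[X], g ≠ 0 → 0 < ∫ x : ℝ, ‖g.eval (x : ℂ)‖ ^ 2 ∂σ

variable {σ : Measure ℝ}

theorem Admissible.memLp (hσ : Admissible σ) (p : ℂ[X]) :
    MemLp (fun x : ℝ => p.eval (x : ℂ)) 2 σ := by
  induction p using Polynomial.induction_on' with
  | add p q hp hq =>
    refine (hp.add hq).ae_eq (Filter.Eventually.of_forall fun x => ?_)
    simp
  | monomial n a =>
    simp only [eval_monomial]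
    refine MemLp.const_mul ?_ a
    rw [memLp_two_iff_integrable_sq_norm (by fun_prop)]
    refine (hσ.moments (2 * n)).congr (Filter.Eventually.of_forall fun x => ?_)
    simp only [norm_pow, Complex.norm_real, Real.norm_eq_abs]
    rw [← pow_mul, mul_comm n 2, pow_mul, pow_mul, sq_abs]

/-- The class `[p]` in `L²_σ` of a complex polynomial `p`. -/
def Admissible.cls (hσ : Admissible σ) : ℂ[X] →ₗ[ℂ] Lp ℂ 2 σ where
  toFun p := (hσ.memLp p).toLp _
  map_add' p q := by
    rw [← MemLp.toLp_add]
    exact MemLp.toLp_congr _ _ (Filter.Eventually.of_forall fun x => by simp)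
  map_smul' c p := by
    rw [RingHom.id_apply, ← MemLp.toLp_const_smul]
    exact MemLp.toLp_congr _ _ (Filter.Eventually.of_forall fun x => by simp)

/-- The subspace `𝒫` of all classes of polynomials in `L²_σ`. -/
abbrev Admissible.polys (hσ : Admissible σ) : Submodule ℂ (Lp ℂ 2 σ) :=
  LinearMap.range hσ.cls

/-- The class of a polynomial, as an element of `𝒫`. -/
abbrev Admissible.toPolys (hσ : Admissible σ) (p : ℂ[X]) : hσ.polys :=
  hσ.cls.rangeRestrict p

theorem Admissible.mul_ae (hσ : Admissible σ) (p : ℂ[X]) :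
    (fun x : ℝ => (x : ℂ) * (hσ.cls p : ℝ → ℂ) x) =ᵐ[σ] fun x : ℝ => (X * p).eval (x : ℂ) := by
  have h : (hσ.cls p : ℝ → ℂ) =ᵐ[σ] fun x : ℝ => p.eval (x : ℂ) := (hσ.memLp p).coeFn_toLp
  filter_upwards [h] with x hx
  rw [hx, eval_mul, eval_X]

theorem Admissible.mul_memLp (hσ : Admissible σ) (f : hσ.polys) :
    MemLp (fun x : ℝ => (x : ℂ) * ((f : Lp ℂ 2 σ) : ℝ → ℂ) x) 2 σ := by
  obtain ⟨_, p, rfl⟩ := f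
  exact (hσ.memLp (X * p)).ae_eq (hσ.mul_ae p).symm

/-- The operator `Λ₀` of multiplication by the independent variable, restricted to `𝒫`. -/
def Admissible.mulX (hσ : Admissible σ) : Module.End ℂ hσ.polys where
  toFun f := ⟨(hσ.mul_memLp f).toLp _, by
    obtain ⟨_, p, rfl⟩ := f
    exact ⟨X * p, MemLp.toLp_congr (hσ.memLp (X * p)) _ (hσ.mul_ae p).symm⟩⟩
  map_add' f g := by
    apply Subtype.ext
    change (hσ.mul_memLp (f + g)).toLp _ = (hσ.mul_memLp f).toLp _ + (hσ.mul_memLp g).toLp _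
    rw [← MemLp.toLp_add]
    refine MemLp.toLp_congr _ _ ?_
    filter_upwards [Lp.coeFn_add (f : Lp ℂ 2 σ) (g : Lp ℂ 2 σ)] with x hx
    simp only [Submodule.coe_add, Pi.add_apply] at hx ⊢
    rw [hx, mul_add]
  map_smul' c f := by
    apply Subtype.ext
    change (hσ.mul_memLp (c • f)).toLp _ = c • (hσ.mul_memLp f).toLp _
    rw [← MemLp.toLp_const_smul]
    refine MemLp.toLp_congr _ _ ?_
    filter_upwards [Lp.coeFn_smul c (f : Lp ℂ 2 σ)] with x hx
    simp only [Submodule.coe_smul, Pi.smul_apply, smul_eq_mul] at hx ⊢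
    rw [hx, mul_left_comm]

/-- For each `k`, `𝒜 x^k = ξ_{k,k+1} x^{k+1} + ∑_{j ≤ k} ξ_{k,j} x^j` with `ξ_{k,k+1} > 0` and all
`ξ_{k,j}` real. -/
def IsExpansion (hσ : Admissible σ) (𝒜 : Module.End ℂ hσ.polys) (ξ : ℕ → ℕ → ℝ) : Prop :=
  ∀ k, 0 < ξ k (k + 1) ∧
    𝒜 (hσ.toPolys (X ^ k)) = hσ.toPolys (C (ξ k (k + 1) : ℂ) * X ^ (k + 1) +
      ∑ j ∈ Finset.range (k + 1), C (ξ k j : ℂ) * X ^ j)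

/-- The conditions on the operator `𝒜`. A linear operator in `L²_σ` with domain `𝒫` that satisfies
`expansion` maps `𝒫` into `𝒫`; it is therefore given as an endomorphism of `𝒫`. -/
structure IsModelOperator (hσ : Admissible σ) (𝒜 : Module.End ℂ hσ.polys) : Prop where
  expansion : ∃ ξ : ℕ → ℕ → ℝ, IsExpansion hσ 𝒜 ξ
  symmetric : (𝒜 ∘ₗ hσ.mulX).IsSymmetric

/-- `S(u, v) = ∫ u(𝒜)(1) conj(v(𝒜)(1)) dσ` for all complex polynomials `u`, `v`. -/
def Represents (hσ : Admissible σ) (𝒜 : Module.End ℂ hσ.polys)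
    (S : ℂ[X] →ₗ[ℂ] ℂ[X] →ₗ⋆[ℂ] ℂ) : Prop :=
  ∀ u v : ℂ[X], S u v =
    ∫ x : ℝ, ((aeval 𝒜 u (hσ.toPolys 1) : Lp ℂ 2 σ) : ℝ → ℂ) x *
      conj (((aeval 𝒜 v (hσ.toPolys 1) : Lp ℂ 2 σ) : ℝ → ℂ) x) ∂σ

/-- `r` is the system of orthonormal polynomials of `σ` with positive leading coefficients. -/
structure IsOrthonormalSystem (σ : Measure ℝ) (r : ℕ → ℝ[X]) : Prop where
  natDegree_eq : ∀ n, (r n).natDegree = n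
  leadingCoeff_pos : ∀ n, 0 < (r n).leadingCoeff
  orthonormal : ∀ n m, ∫ x, (r n).eval x * (r m).eval x ∂σ = if n = m then 1 else 0

/-- `Θ` is the pencil reconstructed from `σ` and `𝒜`: with the orthonormal polynomials `r` of `σ`,
`J₃` is the Jacobi matrix of their recurrence coefficients (`J₃ r⃗(λ) = λ r⃗(λ)`),
`J₅` is the matrix `(𝒜 Λ₀ rₙ, rₘ)` (the scalar product, linear in its first argument,
is `inner ℂ rₘ (𝒜 Λ₀ rₙ)`), and `α`, `β` are computed from
`𝒜 1 = ξ_{0,1} x + ξ_{0,0}` and the first two moments `s₁`, `s₂` of `σ`. -/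
structure IsReconstructed (hσ : Admissible σ) (𝒜 : Module.End ℂ hσ.polys) (ξ : ℕ → ℕ → ℝ)
    (r : ℕ → ℝ[X]) (Θ : Pencil) : Prop where
  J₃_eq : ∀ n, ∑ m ∈ Finset.range (n + 2), C (Θ.J₃ n m) * r m = X * r n
  J₅_eq : ∀ m n, (Θ.J₅ m n : ℂ) =
    inner ℂ (hσ.toPolys ((r m).map Complex.ofRealHom))
      (𝒜 (hσ.mulX (hσ.toPolys ((r n).map Complex.ofRealHom))))
  α_eq : Θ.α = 1 / (ξ 0 1 * √((∫ x, x ^ 2 ∂σ) - (∫ x, x ∂σ) ^ 2))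
  β_eq : Θ.β = -(ξ 0 1 * (∫ x, x ∂σ) + ξ 0 0) /
    (ξ 0 1 * √((∫ x, x ^ 2 ∂σ) - (∫ x, x ∂σ) ^ 2))

end JacobiPencil

end

/-! Everything rests on one linear automorphism e of the polynomials, u ↦ u(𝒜)(1). It turns
multiplication by λ into 𝒜 and S into the scalar product of L²_σ, and it carries the associated
polynomials pₙ to the orthonormal polynomials rₙ of σ. Apply e to row n of the pencil, λ ∑ J₃ pₘ = ∑
J₅ pₘ, and use ∑ J₃ rₘ = x rₙ: the result is 𝒜Λ₀ rₙ = ∑ J₅ rₘ. So J₅ is the matrix of 𝒜Λ₀ in the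
orthonormal system, and its symmetry is the symmetry of 𝒜Λ₀.

Given a pencil, Favard's theorem (`exists_admissible_of_jacobi`) produces σ from J₃. Then e is
defined by pₙ ↦ rₙ and 𝒜 by conjugating multiplication by λ with e
(`exists_model_of_isSpectralFunction`). Given σ and 𝒜, the map u ↦ u(𝒜)(1) is invertible because it
is triangular, and pₙ = e⁻¹ rₙ (`exists_reconstructed_pencil`).

The reality, band and sign conditions reduce to degree counts with `IsPosReal`. Favard's theorem
follows from the Hamburger moment problem (`exists_measure_of_nonneg_sq`), which is proved with the
M. Riesz extension theorem and the Riesz–Markov–Kakutani theorem. -/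

noncomputable section

open MeasureTheory Polynomial ComplexConjugate

namespace JacobiPencil

/-! ### The Hamburger moment problem. -/

section Hamburger

open Filter Topology CompactlySupported

/-- A real polynomial that is nonnegative on the real line is a sum of two squares. -/
theorem exists_eq_sq_add_sq_of_eval_nonneg (p : ℝ[X]) (hp : ∀ x, 0 ≤ p.eval x) :
    ∃ a b : ℝ[X], p = a ^ 2 + b ^ 2 := by
  induction hn : p.natDegree using Nat.strong_induction_on generalizing p with
  | _ n ih =>
  subst hn
  rcases Nat.eq_zero_or_pos p.natDegree with h0 | hpos
  · obtain ⟨c, rfl⟩ := natDegree_eq_zero.1 h0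
    have hc : 0 ≤ c := by simpa using hp 0
    refine ⟨C √c, 0, ?_⟩
    rw [← C_pow, Real.sq_sqrt hc]
    simp
  have hp0 : p ≠ 0 := by rintro rfl; simp at hpos
  have quotient_sq : ∀ d q : ℝ[X], p = d * q → d.natDegree = 2 →
      (∀ x, 0 ≤ d.eval x) →
      ∃ a b : ℝ[X], q = a ^ 2 + b ^ 2 := by
    intro d q hdq hd hdpos
    have hd0 : d ≠ 0 := by rintro rfl; simp at hd
    have hq0 : q ≠ 0 := by rintro rfl; simp [hdq] at hp0
    refine ih q.natDegree ?_ q ?_ rfl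
    · rw [hdq, natDegree_mul hd0 hq0, hd]; omega
    -- The quotient is nonnegative off the finitely many zeros of d, hence everywhere by continuity.
    · have hdense : Dense {x : ℝ | d.eval x ≠ 0} := by
        have hfin : {x : ℝ | d.eval x = 0}.Finite := by
          refine (d.roots.toFinset.finite_toSet).subset fun x hx => ?_
          simpa [hd0] using hx
        exact hfin.countable.dense_compl ℝ
      have hclosed : IsClosed {x : ℝ | 0 ≤ q.eval x} :=
        isClosed_le continuous_const q.continuous
      intro x
      have hsub : {x : ℝ | d.eval x ≠ 0} ⊆ {x : ℝ | 0 ≤ q.eval x} := by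
        intro y hy
        have h1 := hp y
        rw [hdq, eval_mul] at h1
        exact nonneg_of_mul_nonneg_right h1 (lt_of_le_of_ne (hdpos y) (Ne.symm hy))
      exact (hclosed.closure_subset_iff.2 hsub) (hdense x)
  obtain ⟨z, hz⟩ : ∃ z : ℂ, aeval z p = 0 := by
    apply IsAlgClosed.exists_aeval_eq_zero
    exact fun h => hpos.ne' (natDegree_eq_of_degree_eq_some h)
  by_cases him : z.im = 0
  · obtain ⟨a, rfl⟩ : ∃ a : ℝ, (a : ℂ) = z := ⟨z.re, Complex.ext rfl (by simp [him])⟩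
    have hroot : p.IsRoot a := by
      have := hz
      rw [show (a : ℂ) = algebraMap ℝ ℂ a from rfl, aeval_algebraMap_apply] at this
      simpa using this
    -- A real root is a minimum of p, so it is at least a double root.
    have hder : p.derivative.eval a = 0 := by
      have hmin : IsLocalMin (fun x => p.eval x) a :=
        Eventually.of_forall fun x => hroot.eq_zero.trans_le (hp x)
      have := hmin.deriv_eq_zero
      simpa using this
    obtain ⟨q, hq⟩ : (X - C a) ^ 2 ∣ p := by
      obtain ⟨s, hs⟩ := dvd_iff_isRoot.2 hroot
      rw [hs, derivative_mul] at hder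
      have : s.IsRoot a := by simpa using hder
      obtain ⟨t, ht⟩ := dvd_iff_isRoot.2 this
      exact ⟨t, by rw [hs, ht]; ring⟩
    obtain ⟨u, v, huv⟩ := quotient_sq _ q hq (by simp)
      (fun x => by simp; positivity)
    exact ⟨(X - C a) * u, (X - C a) * v, by rw [hq, huv]; ring⟩
  · have hquad : X ^ 2 - C (2 * z.re) * X + C (‖z‖ ^ 2) = (X - C z.re) ^ 2 + C z.im ^ 2 := by
      rw [← Complex.normSq_eq_norm_sq, Complex.normSq_apply]
      simp only [C_mul, C_add, C_ofNat]
      ring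
    obtain ⟨q, hq⟩ := p.quadratic_dvd_of_aeval_eq_zero_im_ne_zero hz him
    rw [hquad] at hq
    obtain ⟨u, v, huv⟩ := quotient_sq _ q hq (by
        rw [← C_pow, natDegree_add_C]; simp)
      (fun x => by simp; positivity)
    -- Brahmagupta's identity: a product of sums of two squares is a sum of two squares.
    exact ⟨(X - C z.re) * u + C z.im * v, (X - C z.re) * v - C z.im * u, by
      rw [hq, huv]; ring⟩

/-- The space of continuous functions on the line dominated by a polynomial. -/
def polyBounded : Submodule ℝ (ℝ → ℝ) where
  carrier := {f | Continuous f ∧ ∃ p : ℝ[X], ∀ x, |f x| ≤ p.eval x}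
  zero_mem' := ⟨continuous_const, 0, by simp⟩
  add_mem' := by
    rintro f g ⟨hf, p, hp⟩ ⟨hg, q, hq⟩
    refine ⟨hf.add hg, p + q, fun x => ?_⟩
    rw [eval_add]
    exact (abs_add_le _ _).trans (add_le_add (hp x) (hq x))
  smul_mem' := by
    rintro c f ⟨hf, p, hp⟩
    refine ⟨hf.const_smul c, C |c| * p, fun x => ?_⟩
    simp only [Pi.smul_apply, smul_eq_mul, abs_mul, eval_mul, eval_C]
    exact mul_le_mul_of_nonneg_left (hp x) (abs_nonneg c)

/-- The polynomial function of a real polynomial, as an element of `polyBounded`. -/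
def polyFun : ℝ[X] →ₗ[ℝ] polyBounded where
  toFun p := ⟨fun x => p.eval x, p.continuous, p ^ 2 + 1, fun x => by
    simp only [eval_add, eval_pow, eval_one]
    rw [abs_le]
    constructor <;> nlinarith [sq_nonneg (p.eval x - 1), sq_nonneg (p.eval x + 1)]⟩
  map_add' p q := by ext x; simp
  map_smul' c p := by ext x; simp

theorem polyFun_apply (p : ℝ[X]) (x : ℝ) : (polyFun p : ℝ → ℝ) x = p.eval x := rfl

theorem polyFun_injective : Function.Injective polyFun := by
  intro p q h
  refine Polynomial.funext fun x => ?_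
  rw [← polyFun_apply, h, polyFun_apply]

/-- The cone of nonnegative functions. -/
def nonnegCone : PointedCone ℝ polyBounded where
  carrier := {f | ∀ x, 0 ≤ (f : ℝ → ℝ) x}
  zero_mem' := fun _ => le_rfl
  add_mem' := fun hf hg x => add_nonneg (hf x) (hg x)
  smul_mem' := fun c _ hf x => mul_nonneg c.2 (hf x)

/-- A functional on polynomials that is nonnegative on squares extends to a positive functional on
the polynomially bounded continuous functions. -/
theorem exists_positive_extension (L : ℝ[X] →ₗ[ℝ] ℝ) (hL : ∀ u, 0 ≤ L (u ^ 2)) :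
    ∃ G : polyBounded →ₗ[ℝ] ℝ, (∀ p, G (polyFun p) = L p) ∧
      ∀ f : polyBounded, (∀ x, 0 ≤ (f : ℝ → ℝ) x) → 0 ≤ G f := by
  let e := LinearEquiv.ofInjective polyFun polyFun_injective
  let f : polyBounded →ₗ.[ℝ] ℝ := ⟨LinearMap.range polyFun, L ∘ₗ e.symm.toLinearMap⟩
  have hf : ∀ p, f (e p) = L p := fun p => by
    change L (e.symm (e p)) = L p
    rw [e.symm_apply_apply]
  have hnonneg : ∀ x : f.domain, (x : polyBounded) ∈ nonnegCone → 0 ≤ f x := by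
    intro x hx
    obtain ⟨p, rfl⟩ := e.surjective x
    rw [hf]
    obtain ⟨a, b, rfl⟩ := exists_eq_sq_add_sq_of_eval_nonneg p fun x => hx x
    rw [map_add]
    exact add_nonneg (hL a) (hL b)
  -- Cofinality of the polynomials, required by the M. Riesz extension theorem; `polyBounded` is
  -- chosen so that it holds.
  have hdense : ∀ y, ∃ x : f.domain, (x : polyBounded) + y ∈ nonnegCone := by
    rintro ⟨y, hy, p, hp⟩
    refine ⟨e p, fun x => ?_⟩
    have := neg_le_of_abs_le (hp x)
    change 0 ≤ p.eval x + y x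
    linarith
  obtain ⟨G, hG, hpos⟩ := riesz_extension nonnegCone f hnonneg hdense
  exact ⟨G, fun p => (hG (e p)).trans (hf p), hpos⟩

/-- A compactly supported function as a polynomially bounded function. -/
def compactlySupportedIncl : C_c(ℝ, ℝ) →ₗ[ℝ] polyBounded where
  toFun f := ⟨f, f.continuous, by
    obtain ⟨c, hc⟩ := f.hasCompactSupport.exists_bound_of_continuous f.continuous
    exact ⟨C c, fun x => by simpa using hc x⟩⟩
  map_add' _ _ := rfl
  map_smul' _ _ := rfl

/-- The trapezoidal cutoff function: `1` on `[-n, n]` and `0` outside `[-(n+1), n+1]`. -/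
def cutoff (n : ℕ) (x : ℝ) : ℝ := max 0 (min 1 (n + 1 - |x|))

theorem cutoff_nonneg (n : ℕ) (x : ℝ) : 0 ≤ cutoff n x := le_max_left _ _

theorem cutoff_le_one (n : ℕ) (x : ℝ) : cutoff n x ≤ 1 := max_le zero_le_one (min_le_left _ _)

theorem continuous_cutoff (n : ℕ) : Continuous (cutoff n) := by unfold cutoff; fun_prop

theorem cutoff_eq_one {n : ℕ} {x : ℝ} (h : |x| ≤ n) : cutoff n x = 1 := by
  unfold cutoff
  rw [min_eq_left (by linarith), max_eq_right zero_le_one]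

theorem hasCompactSupport_cutoff (n : ℕ) : HasCompactSupport (cutoff n) := by
  refine HasCompactSupport.intro (isCompact_Icc (a := -(n + 1 : ℝ)) (b := n + 1)) fun x hx => ?_
  have : (n + 1 : ℝ) < |x| := by
    by_contra h
    exact hx (abs_le.1 (not_lt.1 h))
  unfold cutoff
  exact max_eq_left ((min_le_right _ _).trans (by linarith))

/-- A polynomial multiplied by the cutoff function. -/
def cutPoly (p : ℝ[X]) (n : ℕ) : C_c(ℝ, ℝ) :=
  ⟨⟨fun x => p.eval x * cutoff n x, p.continuous.mul (continuous_cutoff n)⟩,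
    (hasCompactSupport_cutoff n).mul_left⟩

theorem cutPoly_apply (p : ℝ[X]) (n : ℕ) (x : ℝ) : cutPoly p n x = p.eval x * cutoff n x := rfl

theorem tendsto_cutPoly (p : ℝ[X]) (x : ℝ) :
    Tendsto (fun n => cutPoly p n x) atTop (𝓝 (p.eval x)) := by
  obtain ⟨N, hN⟩ := exists_nat_ge |x|
  refine tendsto_const_nhds.congr' ?_
  filter_upwards [eventually_ge_atTop N] with n hn
  rw [cutPoly_apply, cutoff_eq_one (hN.trans (by exact_mod_cast hn)), mul_one]

/-- The **Hamburger moment problem**: a functional on real polynomials that is nonnegative on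
squares is the integral with respect to a measure. -/
theorem exists_measure_of_nonneg_sq (L : ℝ[X] →ₗ[ℝ] ℝ) (hL : ∀ u, 0 ≤ L (u ^ 2)) :
    ∃ σ : Measure ℝ, ∀ p : ℝ[X], Integrable (fun x => p.eval x) σ ∧ ∫ x, p.eval x ∂σ = L p := by
  obtain ⟨G, hG, hpos⟩ := exists_positive_extension L hL
  have hmono : ∀ f g : polyBounded, (∀ x, (f : ℝ → ℝ) x ≤ (g : ℝ → ℝ) x) → G f ≤ G g := by
    intro f g h
    have := hpos (g - f) fun x => sub_nonneg.2 (h x)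
    rwa [map_sub, sub_nonneg] at this
  let Λ : C_c(ℝ, ℝ) →ₚ[ℝ] ℝ :=
    PositiveLinearMap.mk₀ (G ∘ₗ compactlySupportedIncl) fun f hf => hpos _ fun x => hf x
  have hΛ : ∀ f, Λ f = G (compactlySupportedIncl f) := fun _ => rfl
  have key : ∀ p : ℝ[X], (∀ x, 0 ≤ p.eval x) →
      Integrable (fun x => p.eval x) (RealRMK.rieszMeasure Λ) ∧
        ∫ x, p.eval x ∂(RealRMK.rieszMeasure Λ) = L p := by
    intro p hp
    have hle : ∀ n, Λ (cutPoly p n) ≤ L p := fun n => by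
      rw [hΛ, ← hG]
      exact hmono _ _ fun x => mul_le_of_le_one_right (hp x) (cutoff_le_one n x)
    have hcint : ∀ n, Integrable (cutPoly p n) (RealRMK.rieszMeasure Λ) := fun n =>
      (cutPoly p n).continuous.integrable_of_hasCompactSupport (cutPoly p n).hasCompactSupport
    have hcnn : ∀ n x, 0 ≤ cutPoly p n x := fun n x => mul_nonneg (hp x) (cutoff_nonneg n x)
    -- Fatou's lemma along the cutoffs, whose integrals are bounded by L p.
    have hint : Integrable (fun x => p.eval x) (RealRMK.rieszMeasure Λ) := by
      refine ⟨p.continuous.aestronglyMeasurable, ?_⟩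
      rw [hasFiniteIntegral_iff_ofReal (Eventually.of_forall hp)]
      refine lt_of_le_of_lt ?_ (ENNReal.ofReal_lt_top (r := L p))
      calc ∫⁻ x, ENNReal.ofReal (p.eval x) ∂(RealRMK.rieszMeasure Λ)
          = ∫⁻ x, liminf (fun n => ENNReal.ofReal (cutPoly p n x)) atTop
              ∂(RealRMK.rieszMeasure Λ) := by
            refine lintegral_congr fun x => ?_
            exact ((ENNReal.tendsto_ofReal (tendsto_cutPoly p x)).liminf_eq).symm
        _ ≤ liminf (fun n => ∫⁻ x, ENNReal.ofReal (cutPoly p n x) ∂(RealRMK.rieszMeasure Λ))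
              atTop := lintegral_liminf_le fun n =>
                (cutPoly p n).continuous.measurable.ennreal_ofReal
        _ ≤ liminf (fun _ : ℕ => ENNReal.ofReal (L p)) atTop := by
            refine liminf_le_liminf (Eventually.of_forall fun n => ?_)
            rw [← ofReal_integral_eq_lintegral_ofReal (hcint n)
              (Eventually.of_forall (hcnn n)), RealRMK.integral_rieszMeasure]
            exact ENNReal.ofReal_le_ofReal (hle n)
        _ = ENNReal.ofReal (L p) := liminf_const _
    refine ⟨hint, ?_⟩
    have h1 : Tendsto (fun n => Λ (cutPoly p n)) atTop
        (𝓝 (∫ x, p.eval x ∂(RealRMK.rieszMeasure Λ))) := by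
      have := tendsto_integral_of_dominated_convergence (μ := RealRMK.rieszMeasure Λ)
        (F := fun n x => cutPoly p n x) (fun x => p.eval x)
        (fun n => (cutPoly p n).continuous.aestronglyMeasurable) hint
        (fun n => Eventually.of_forall fun x => by
          rw [Real.norm_of_nonneg (hcnn n x)]
          exact mul_le_of_le_one_right (hp x) (cutoff_le_one n x))
        (Eventually.of_forall fun x => tendsto_cutPoly p x)
      simpa only [RealRMK.integral_rieszMeasure] using this
    have h2 : Tendsto (fun n => Λ (cutPoly p n)) atTop (𝓝 (L p)) := by
      -- No mass escapes to infinity: the cutoff is 1 on |x| ≤ n, and for |x| ≥ n one has p ≤ x² p /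
      -- n².
      have hlow : ∀ n : ℕ, 0 < n → L p - L (X ^ 2 * p) / n ^ 2 ≤ Λ (cutPoly p n) := by
        intro n hn
        have hn' : (0 : ℝ) < n := by exact_mod_cast hn
        have : L p - L (X ^ 2 * p) / n ^ 2 = L (p - C ((n : ℝ) ^ 2)⁻¹ * (X ^ 2 * p)) := by
          rw [map_sub, ← smul_eq_C_mul, map_smul, smul_eq_mul, div_eq_inv_mul]
        rw [this, ← hG, hΛ]
        refine hmono _ _ fun x => ?_
        change (p - C ((n : ℝ) ^ 2)⁻¹ * (X ^ 2 * p)).eval x ≤ p.eval x * cutoff n x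
        simp only [eval_sub, eval_mul, eval_C, eval_pow, eval_X]
        rcases le_total |x| n with hx | hx
        · rw [cutoff_eq_one hx, mul_one]
          have := hp x
          have : 0 ≤ ((n : ℝ) ^ 2)⁻¹ * (x ^ 2 * p.eval x) := by positivity
          linarith
        · have h3 : 1 ≤ ((n : ℝ) ^ 2)⁻¹ * x ^ 2 := by
            rw [← div_eq_inv_mul, one_le_div (by positivity), ← sq_abs x]
            exact pow_le_pow_left₀ hn'.le hx 2
          have h4 := mul_le_mul_of_nonneg_right h3 (hp x)
          have h5 := mul_nonneg (hp x) (cutoff_nonneg n x)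
          rw [one_mul, mul_assoc] at h4
          linarith
      have hlim : Tendsto (fun n : ℕ => L p - L (X ^ 2 * p) / (n : ℝ) ^ 2) atTop (𝓝 (L p)) := by
        have : Tendsto (fun n : ℕ => L (X ^ 2 * p) / (n : ℝ) ^ 2) atTop (𝓝 0) :=
          Tendsto.div_atTop tendsto_const_nhds
            ((tendsto_pow_atTop two_ne_zero).comp tendsto_natCast_atTop_atTop)
        simpa using tendsto_const_nhds.sub this
      refine tendsto_of_tendsto_of_tendsto_of_le_of_le' hlim tendsto_const_nhds ?_
        (Eventually.of_forall hle)
      filter_upwards [eventually_gt_atTop 0] with n hn using hlow n hn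
    exact tendsto_nhds_unique h1 h2
  refine ⟨RealRMK.rieszMeasure Λ, fun p => ?_⟩
  -- Polarization, 4p = (p + 1)² - (p - 1)², reduces a general p to nonnegative polynomials.
  obtain ⟨h1, e1⟩ := key ((p + 1) ^ 2) fun x => by rw [eval_pow]; positivity
  obtain ⟨h2, e2⟩ := key ((p - 1) ^ 2) fun x => by rw [eval_pow]; positivity
  have hfun : (fun x => p.eval x) =
      fun x => (1 / 4 : ℝ) * (((p + 1) ^ 2).eval x - ((p - 1) ^ 2).eval x) := by
    funext x
    simp only [eval_pow, eval_add, eval_sub, eval_one]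
    ring
  rw [hfun]
  refine ⟨(h1.sub h2).const_mul _, ?_⟩
  rw [integral_const_mul, integral_sub h1 h2, e1, e2, ← map_sub, ← smul_eq_mul, ← map_smul]
  congr 1
  rw [smul_eq_C_mul, show (p + 1) ^ 2 - (p - 1) ^ 2 = C 4 * p by rw [C_ofNat]; ring, ← mul_assoc,
    ← C_mul]
  norm_num

end Hamburger

/-! ### Triangular systems of polynomials with real coefficients. -/

section Triangular

variable {K : Type*} [Field K] [Algebra ℝ K]

variable (K) in
/-- The polynomials of degree less than `n` with real coefficients. -/
def realLT (n : ℕ) : Submodule ℝ K[X] := Submodule.span ℝ ((fun k => X ^ k) '' Set.Iio n)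

/-- `p` has real coefficients, degree `n` and a positive leading coefficient. -/
def IsPosReal (n : ℕ) (p : K[X]) : Prop := ∃ a : ℝ, 0 < a ∧ p - a • X ^ n ∈ realLT K n

theorem realLT_mono {m n : ℕ} (h : m ≤ n) : realLT K m ≤ realLT K n :=
  Submodule.span_mono (Set.image_mono (Set.Iio_subset_Iio h))

theorem X_pow_mem_realLT {k n : ℕ} (h : k < n) : (X ^ k : K[X]) ∈ realLT K n :=
  Submodule.subset_span ⟨k, h, rfl⟩

theorem isPosReal_X_pow (n : ℕ) : IsPosReal n (X ^ n : K[X]) := ⟨1, one_pos, by simp⟩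

theorem isPosReal_zero_one : IsPosReal 0 (1 : K[X]) := by simpa using isPosReal_X_pow (K := K) 0

theorem IsPosReal.mem {n : ℕ} {p : K[X]} (hp : IsPosReal n p) : p ∈ realLT K (n + 1) := by
  obtain ⟨a, -, ha⟩ := hp
  have := add_mem (realLT_mono n.le_succ ha)
    (Submodule.smul_mem _ a (X_pow_mem_realLT (K := K) n.lt_succ_self))
  rwa [sub_add_cancel] at this

theorem IsPosReal.mem_of_lt {m n : ℕ} {p : K[X]} (hp : IsPosReal m p) (h : m < n) :
    p ∈ realLT K n := realLT_mono h hp.mem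

theorem IsPosReal.add_mem {n : ℕ} {p q : K[X]} (hp : IsPosReal n p) (hq : q ∈ realLT K n) :
    IsPosReal n (p + q) := by
  obtain ⟨a, ha0, ha⟩ := hp
  exact ⟨a, ha0, by rw [add_sub_right_comm]; exact Submodule.add_mem _ ha hq⟩

theorem IsPosReal.smul {n : ℕ} {p : K[X]} (hp : IsPosReal n p) {c : ℝ} (hc : 0 < c) :
    IsPosReal n (c • p) := by
  obtain ⟨a, ha0, ha⟩ := hp
  exact ⟨c * a, mul_pos hc ha0, by rw [mul_smul, ← smul_sub]; exact Submodule.smul_mem _ _ ha⟩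

theorem X_mul_mem_realLT {n : ℕ} {p : K[X]} (hp : p ∈ realLT K n) :
    X * p ∈ realLT K (n + 1) := by
  have h : realLT K n ≤ (realLT K (n + 1)).comap (LinearMap.mulLeft ℝ (X : K[X])) := by
    refine Submodule.span_le.2 ?_
    rintro _ ⟨k, hk, rfl⟩
    simp only [Submodule.comap_coe, Set.mem_preimage, LinearMap.mulLeft_apply, SetLike.mem_coe,
      ← pow_succ']
    exact X_pow_mem_realLT (Nat.succ_lt_succ hk)
  exact h hp

theorem IsPosReal.X_mul {n : ℕ} {p : K[X]} (hp : IsPosReal n p) : IsPosReal (n + 1) (X * p) := by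
  obtain ⟨a, ha0, ha⟩ := hp
  refine ⟨a, ha0, ?_⟩
  have := X_mul_mem_realLT ha
  rwa [mul_sub, mul_smul_comm, ← pow_succ'] at this

theorem IsPosReal.exists_sub_smul_mem {n : ℕ} {p q : K[X]} (hq : IsPosReal n q)
    (hp : IsPosReal n p) : ∃ c : ℝ, 0 < c ∧ q - c • p ∈ realLT K n := by
  obtain ⟨a, ha0, ha⟩ := hp
  obtain ⟨b, hb0, hb⟩ := hq
  refine ⟨b / a, div_pos hb0 ha0, ?_⟩
  have := sub_mem hb (Submodule.smul_mem _ (b / a) ha)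
  rw [smul_sub, smul_smul, div_mul_cancel₀ _ ha0.ne'] at this
  convert this using 1
  abel

theorem exists_sum_of_mem_realLT {p : ℕ → K[X]} (hp : ∀ n, IsPosReal n (p n)) {n : ℕ} {q : K[X]}
    (hq : q ∈ realLT K n) :
    ∃ c : ℕ → ℝ, (∀ k, n ≤ k → c k = 0) ∧ q = ∑ k ∈ Finset.range n, c k • p k := by
  induction n generalizing q with
  | zero =>
    have : q = 0 := by simpa [realLT] using hq
    exact ⟨0, by simp, by simp [this]⟩
  | succ n ih =>
    obtain ⟨t, ht⟩ : ∃ t : ℝ, q - t • p n ∈ realLT K n := by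
      have hle : realLT K (n + 1) ≤ realLT K n ⊔ Submodule.span ℝ {p n} := by
        refine Submodule.span_le.2 ?_
        rintro _ ⟨k, hk, rfl⟩
        rcases (Nat.lt_succ_iff_lt_or_eq.1 hk) with h | rfl
        · exact Submodule.mem_sup_left (X_pow_mem_realLT h)
        · obtain ⟨c, -, hc⟩ := (isPosReal_X_pow (K := K) k).exists_sub_smul_mem (hp k)
          have := add_mem (Submodule.mem_sup_left hc : _ ∈ realLT K k ⊔ Submodule.span ℝ {p k})
            (Submodule.mem_sup_right (Submodule.smul_mem _ c (Submodule.mem_span_singleton_self _)))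
          rwa [sub_add_cancel] at this
      obtain ⟨s, hs, y, hy, rfl⟩ := Submodule.mem_sup.1 (hle hq)
      obtain ⟨t, rfl⟩ := Submodule.mem_span_singleton.1 hy
      exact ⟨t, by rwa [add_sub_cancel_right]⟩
    obtain ⟨c, hc0, hc⟩ := ih ht
    refine ⟨Function.update c n t, fun k hk => ?_, ?_⟩
    · rw [Function.update_of_ne (by omega), hc0 k (by omega)]
    · rw [Finset.sum_range_succ, Function.update_self, ← sub_eq_iff_eq_add, hc]
      refine Finset.sum_congr rfl fun k hk => ?_
      rw [Function.update_of_ne (Finset.mem_range.1 hk).ne]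

/-- Source of the matrix entries of a pencil: the positive top coefficient becomes an outermost
diagonal entry, and the vanishing of the later coefficients gives the band structure. -/
theorem IsPosReal.exists_sum {p : ℕ → K[X]} (hp : ∀ n, IsPosReal n (p n)) {n : ℕ} {q : K[X]}
    (hq : IsPosReal n q) :
    ∃ c : ℕ → ℝ, 0 < c n ∧ (∀ k, n < k → c k = 0) ∧
      q = ∑ k ∈ Finset.range (n + 1), c k • p k := by
  obtain ⟨t, ht0, ht⟩ := hq.exists_sub_smul_mem (hp n)
  obtain ⟨c, hc0, hc⟩ := exists_sum_of_mem_realLT hp ht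
  refine ⟨Function.update c n t, by simpa, fun k hk => ?_, ?_⟩
  · rw [Function.update_of_ne (by omega), hc0 k (by omega)]
  · rw [Finset.sum_range_succ, Function.update_self, ← sub_eq_iff_eq_add, hc]
    refine Finset.sum_congr rfl fun k hk => ?_
    rw [Function.update_of_ne (Finset.mem_range.1 hk).ne]

/-- A linear map that raises the degrees of a triangular system by `d` and preserves positivity of
leading coefficients does so for all polynomials. -/
theorem IsPosReal.map {p : ℕ → K[X]} (hp : ∀ n, IsPosReal n (p n)) {d : ℕ}
    {B : K[X] →ₗ[K] K[X]} (hB : ∀ n, IsPosReal (n + d) (B (p n))) {n : ℕ} {q : K[X]}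
    (hq : IsPosReal n q) : IsPosReal (n + d) (B q) := by
  obtain ⟨c, hc, -, rfl⟩ := hq.exists_sum hp
  have hsmul : ∀ (a : ℝ) (u : K[X]), B (a • u) = a • B u := fun a u => by
    rw [← algebraMap_smul K a u, map_smul, algebraMap_smul]
  rw [Finset.sum_range_succ, map_add, add_comm (B _), hsmul]
  refine ((hB n).smul hc).add_mem ?_
  rw [map_sum]
  refine Submodule.sum_mem _ fun k hk => ?_
  rw [hsmul]
  have := Finset.mem_range.1 hk
  exact Submodule.smul_mem _ _ ((hB k).mem_of_lt (by omega))

theorem degree_lt_of_mem_realLT {n : ℕ} {p : K[X]} (hp : p ∈ realLT K n) : p.degree < n := by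
  have : realLT K n ≤ (degreeLT K n).restrictScalars ℝ := by
    refine Submodule.span_le.2 ?_
    rintro _ ⟨k, hk, rfl⟩
    exact mem_degreeLT.2 (by simpa using hk)
  exact mem_degreeLT.1 (this hp)

theorem IsPosReal.degree_eq_and_leadingCoeff {n : ℕ} {p : K[X]} (hp : IsPosReal n p) :
    p.degree = n ∧ ∃ a : ℝ, 0 < a ∧ p.leadingCoeff = algebraMap ℝ K a := by
  obtain ⟨a, ha0, ha⟩ := hp
  have hlt := degree_lt_of_mem_realLT ha
  have ha' : algebraMap ℝ K a ≠ 0 := by simpa using ha0.ne'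
  have hdeg : (a • X ^ n : K[X]).degree = n := by
    rw [← algebraMap_smul K a, smul_eq_C_mul, degree_C_mul_X_pow _ ha']
  have hlead : (a • X ^ n : K[X]).leadingCoeff = algebraMap ℝ K a := by
    rw [← algebraMap_smul K a, smul_eq_C_mul, leadingCoeff_C_mul_X_pow]
  have hp : p = (p - a • X ^ n) + a • X ^ n := by abel
  rw [← hdeg] at hlt
  rw [hp, degree_add_eq_right_of_degree_lt hlt, leadingCoeff_add_of_degree_lt hlt]
  exact ⟨hdeg, a, ha0, hlead⟩

theorem IsPosReal.degree_eq {n : ℕ} {p : K[X]} (hp : IsPosReal n p) : p.degree = n :=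
  hp.degree_eq_and_leadingCoeff.1

/-- The basis formed by a triangular system of polynomials. -/
def triangularBasis (p : ℕ → K[X]) (hp : ∀ n, IsPosReal n (p n)) : Module.Basis ℕ K K[X] :=
  Polynomial.Sequence.basis ⟨p, fun n => (hp n).degree_eq⟩ fun n =>
    IsUnit.mk0 _ (leadingCoeff_ne_zero.2 fun h => by
      have h' : p n = 0 := h
      have := (hp n).degree_eq
      simp [h'] at this)

theorem triangularBasis_apply (p : ℕ → K[X]) (hp : ∀ n, IsPosReal n (p n)) (n : ℕ) :
    triangularBasis p hp n = p n :=
  Polynomial.Sequence.basis_eq_self _ _ n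

theorem IsPosReal.map_algebraMap {n : ℕ} {p : ℝ[X]} (hp : IsPosReal n p) :
    IsPosReal n (p.map (algebraMap ℝ K)) := by
  obtain ⟨a, ha0, ha⟩ := hp
  refine ⟨a, ha0, ?_⟩
  have h : realLT ℝ n ≤ (realLT K n).comap (mapAlgHom (Algebra.ofId ℝ K)).toLinearMap := by
    refine Submodule.span_le.2 ?_
    rintro _ ⟨k, hk, rfl⟩
    simpa using X_pow_mem_realLT hk
  have := h ha
  simpa [Algebra.ofId] using this

end Triangular

/-! ### Favard's theorem. -/

/-- The polynomials generated by the three-term recurrence with coefficient matrix `J`. -/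
def recurrencePoly (J : Matrix ℕ ℕ ℝ) : ℕ → ℝ[X]
  | 0 => 1
  | 1 => (J 1 0)⁻¹ • (X * 1 + (-J 0 0) • 1)
  | n + 2 => (J (n + 2) (n + 1))⁻¹ • (X * recurrencePoly J (n + 1) +
      ((-J (n + 1) (n + 1)) • recurrencePoly J (n + 1) + (-J (n + 1) n) • recurrencePoly J n))

section Favard

variable {J : Matrix ℕ ℕ ℝ}

theorem isPosReal_recurrencePoly (hpos : ∀ n, 0 < J (n + 1) n) (n : ℕ) :
    IsPosReal n (recurrencePoly J n) := by
  induction n using Nat.strong_induction_on with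
  | _ n ih =>
  match n, ih with
  | 0, _ => exact isPosReal_zero_one
  | 1, _ =>
    rw [recurrencePoly]
    exact ((isPosReal_zero_one.X_mul).add_mem (Submodule.smul_mem _ _ isPosReal_zero_one.mem)).smul
      (inv_pos.2 (hpos 0))
  | n + 2, ih =>
    rw [recurrencePoly]
    refine (((ih (n + 1) (by omega)).X_mul).add_mem ?_).smul (inv_pos.2 (hpos _))
    exact add_mem (Submodule.smul_mem _ _ (ih (n + 1) (by omega)).mem)
      (Submodule.smul_mem _ _ ((ih n (by omega)).mem_of_lt (by omega)))

theorem sum_smul_recurrencePoly (hsymm : J.IsSymm) (htri : ∀ m n, n + 1 < m → J m n = 0)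
    (hpos : ∀ n, 0 < J (n + 1) n) (n : ℕ) :
    ∑ m ∈ Finset.range (n + 2), J n m • recurrencePoly J m = X * recurrencePoly J n := by
  cases n with
  | zero =>
    simp only [Finset.sum_range_succ, Finset.sum_range_zero, recurrencePoly, zero_add]
    rw [hsymm.apply 1 0, smul_inv_smul₀ (hpos 0).ne', neg_smul]
    abel
  | succ n =>
    rw [Finset.sum_range_succ, Finset.sum_range_succ, Finset.sum_range_succ,
      Finset.sum_eq_zero fun k hk => by
        rw [htri (n + 1) k (by have := Finset.mem_range.1 hk; omega), zero_smul],
      recurrencePoly, hsymm.apply (n + 2) (n + 1), smul_inv_smul₀ (hpos (n + 1)).ne', neg_smul,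
      neg_smul]
    abel

theorem exists_real_add_I_mul (g : ℂ[X]) :
    ∃ a b : ℝ[X], g = a.map (algebraMap ℝ ℂ) + C Complex.I * b.map (algebraMap ℝ ℂ) := by
  induction g using Polynomial.induction_on' with
  | add p q hp hq =>
    obtain ⟨a, b, rfl⟩ := hp
    obtain ⟨c, d, rfl⟩ := hq
    exact ⟨a + c, b + d, by simp only [Polynomial.map_add]; ring⟩
  | monomial n z =>
    refine ⟨monomial n z.re, monomial n z.im, ?_⟩
    simp only [map_monomial, C_mul_monomial, ← map_add]
    congr 1
    apply Complex.ext <;> simp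

theorem eval_map_ofReal (p : ℝ[X]) (x : ℝ) :
    (p.map (algebraMap ℝ ℂ)).eval (x : ℂ) = (p.eval x : ℝ) := by
  have := eval_map_apply (algebraMap ℝ ℂ) (p := p) x
  simpa using this

/-- **Favard's theorem**: the polynomials of a Jacobi matrix are orthonormal with respect to an
admissible measure. -/
theorem exists_admissible_of_jacobi (hsymm : J.IsSymm) (htri : ∀ m n, n + 1 < m → J m n = 0)
    (hpos : ∀ n, 0 < J (n + 1) n) :
    ∃ σ : Measure ℝ, Admissible σ ∧ ∀ n m,
      ∫ x, (recurrencePoly J n).eval x * (recurrencePoly J m).eval x ∂σ =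
        if n = m then 1 else 0 := by
  let r := recurrencePoly J
  let b := triangularBasis r (isPosReal_recurrencePoly hpos)
  have hb : ∀ n, b n = r n := triangularBasis_apply _ _
  -- The bilinear form for which the recurrence polynomials are orthonormal; it remains to represent
  -- it by a measure.
  let B : ℝ[X] →ₗ[ℝ] ℝ[X] →ₗ[ℝ] ℝ := b.constr ℝ fun n => b.coord n
  have hB : ∀ n m, B (b n) (b m) = if n = m then 1 else 0 := fun n m => by
    simp only [B, Module.Basis.constr_basis, Module.Basis.coord_apply, Module.Basis.repr_self,
      Finsupp.single_apply, eq_comm]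
  have hX : ∀ n, X * b n = ∑ m ∈ Finset.range (n + 2), J n m • b m := fun n => by
    simp only [hb]
    exact (sum_smul_recurrencePoly hsymm htri hpos n).symm
  have hBX : ∀ n m, B (X * b n) (b m) = J n m := fun n m => by
    rw [hX]
    simp only [map_sum, map_smul, LinearMap.sum_apply, LinearMap.smul_apply, hB, smul_eq_mul,
      mul_ite, mul_one, mul_zero, Finset.sum_ite_eq', Finset.mem_range]
    split_ifs with h
    · rfl
    · rw [← hsymm.apply, htri m n (by omega)]
  have hBX' : ∀ n m, B (b n) (X * b m) = J m n := fun n m => by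
    rw [hX]
    simp only [map_sum, map_smul, hB, smul_eq_mul,
      mul_ite, mul_one, mul_zero, Finset.sum_ite_eq, Finset.mem_range]
    split_ifs with h
    · rfl
    · rw [← hsymm.apply, htri n m (by omega)]
  -- Symmetry of J makes multiplication by X symmetric for B. Hence B(u, v) depends only on the
  -- product uv and comes from a moment functional.
  have hBmul : B ∘ₗ LinearMap.mulLeft ℝ X = B.compl₂ (LinearMap.mulLeft ℝ X) := by
    refine b.ext fun n => b.ext fun m => ?_
    simp only [LinearMap.comp_apply, LinearMap.mulLeft_apply, LinearMap.compl₂_apply, hBX, hBX']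
    exact (hsymm.apply n m).symm
  have hBX'' : ∀ u v, B (X * u) v = B u (X * v) := fun u v => by
    simpa using LinearMap.congr_fun (LinearMap.congr_fun hBmul u) v
  have hBq : ∀ q u v, B (q * u) v = B u (q * v) := by
    intro q
    induction q using Polynomial.induction_on with
    | C a => intro u v; rw [← smul_eq_C_mul, ← smul_eq_C_mul, map_smul, map_smul]; rfl
    | add p q hp hq => intro u v; rw [add_mul, add_mul, map_add, map_add, LinearMap.add_apply,
        hp, hq]
    | monomial n a ih =>
      intro u v
      rw [pow_succ, ← mul_assoc, mul_assoc _ X u, ih, hBX'']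
      congr 1
      ring
  let L : ℝ[X] →ₗ[ℝ] ℝ := B.flip 1
  have hL : ∀ u v, L (u * v) = B v u := fun u v => by
    change B (u * v) 1 = _
    rw [hBq, mul_one]
  have hBself : ∀ u, B u u = (b.repr u).sum fun _ a => a * a := fun u => by
    simp only [B, Module.Basis.constr_apply, Finsupp.sum, LinearMap.sum_apply,
      LinearMap.smul_apply, Module.Basis.coord_apply, smul_eq_mul]
  have hBnn : ∀ u, 0 ≤ B u u := fun u => by
    rw [hBself]
    exact Finset.sum_nonneg fun i _ => mul_self_nonneg _
  have hBpos : ∀ u, u ≠ 0 → 0 < B u u := fun u hu => by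
    rw [hBself]
    refine Finset.sum_pos (fun i hi => mul_self_pos.2 (Finsupp.mem_support_iff.1 hi)) ?_
    rw [Finsupp.support_nonempty_iff]
    simpa using hu
  obtain ⟨σ, hσ⟩ := exists_measure_of_nonneg_sq L fun u => by rw [sq, hL]; exact hBnn u
  have horth : ∀ u v : ℝ[X], ∫ x, u.eval x * v.eval x ∂σ = B v u := fun u v => by
    rw [← hL, ← (hσ (u * v)).2]
    simp only [eval_mul]
  refine ⟨σ, ⟨?_, ?_, ?_⟩, ?_⟩
  · have h1 := (hσ 1).1
    have h2 := (hσ 1).2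
    have hL1 : L 1 = 1 := by
      have h10 : (1 : ℝ[X]) = b 0 := (hb 0).symm
      have := hL 1 1
      rw [mul_one, h10, hB] at this
      rw [h10]
      simpa using this
    simp only [eval_one, integral_const, smul_eq_mul, mul_one, hL1] at h1 h2
    refine ⟨?_⟩
    have : (σ Set.univ).toReal = 1 := h2
    rw [ENNReal.toReal_eq_one_iff] at this
    exact this
  · intro n
    simpa using (hσ (X ^ n)).1
  · intro g hg
    -- On the real line |a + ic|² = a² + c², so positivity reduces to that of B on real polynomials.
    obtain ⟨a, c, rfl⟩ := exists_real_add_I_mul g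
    have hnorm : ∀ x : ℝ, ‖(a.map (algebraMap ℝ ℂ) + C Complex.I * c.map (algebraMap ℝ ℂ)).eval
        (x : ℂ)‖ ^ 2 = (a * a + c * c).eval x := fun x => by
      rw [← Complex.normSq_eq_norm_sq, eval_add, eval_mul, eval_C, eval_map_ofReal,
        eval_map_ofReal, Complex.normSq_apply]
      simp
    simp only [hnorm]
    rw [(hσ _).2, map_add, hL, hL]
    by_cases ha : a = 0
    · have hc : c ≠ 0 := by rintro rfl; simp [ha] at hg
      exact add_pos_of_nonneg_of_pos (hBnn a) (hBpos c hc)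
    · exact add_pos_of_pos_of_nonneg (hBpos a ha) (hBnn c)
  · intro n m
    rw [horth]
    change B (r m) (r n) = _
    rw [← hb, ← hb, hB]
    simp only [eq_comm]

end Favard

/-! ### Transfer from classes in L²_σ to polynomials. -/

variable {σ : Measure ℝ}

theorem exists_linearEquiv_of_triangular {K : Type*} [Field K] [Algebra ℝ K] {p q : ℕ → K[X]}
    (hp : ∀ n, IsPosReal n (p n)) (hq : ∀ n, IsPosReal n (q n)) :
    ∃ e : K[X] ≃ₗ[K] K[X], ∀ n, e (p n) = q n := by
  refine ⟨(triangularBasis p hp).equiv (triangularBasis q hq) (Equiv.refl ℕ), fun n => ?_⟩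
  rw [← triangularBasis_apply p hp, Module.Basis.equiv_apply, triangularBasis_apply]
  rfl

theorem isPosReal_sum_X_pow {K : Type*} [Field K] [Algebra ℝ K] {n : ℕ} {c : ℕ → ℝ}
    (hc : 0 < c n) : IsPosReal n (∑ j ∈ Finset.range (n + 1), c j • (X ^ j : K[X])) := by
  rw [Finset.sum_range_succ, add_comm]
  refine ((isPosReal_X_pow n).smul hc).add_mem (Submodule.sum_mem _ fun j hj => ?_)
  exact Submodule.smul_mem _ _ (X_pow_mem_realLT (Finset.mem_range.1 hj))

theorem Admissible.coeFn_cls (hσ : Admissible σ) (p : ℂ[X]) :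
    (hσ.cls p : ℝ → ℂ) =ᵐ[σ] fun x : ℝ => p.eval (x : ℂ) := (hσ.memLp p).coeFn_toLp

theorem Admissible.inner_cls (hσ : Admissible σ) (u v : ℂ[X]) :
    inner ℂ (hσ.cls u) (hσ.cls v) = ∫ x : ℝ, v.eval (x : ℂ) * conj (u.eval (x : ℂ)) ∂σ := by
  rw [L2.inner_def]
  refine integral_congr_ae ?_
  filter_upwards [hσ.coeFn_cls u, hσ.coeFn_cls v] with x hu hv
  rw [hu, hv, RCLike.inner_apply]

theorem Admissible.inner_cls_X_mul (hσ : Admissible σ) (u v : ℂ[X]) :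
    inner ℂ (hσ.cls (X * u)) (hσ.cls v) = inner ℂ (hσ.cls u) (hσ.cls (X * v)) := by
  rw [hσ.inner_cls, hσ.inner_cls]
  refine integral_congr_ae (Filter.Eventually.of_forall fun x => ?_)
  simp only [eval_mul, eval_X, map_mul, Complex.conj_ofReal]
  ring

theorem Admissible.inner_cls_map (hσ : Admissible σ) (a b : ℝ[X]) :
    inner ℂ (hσ.cls (a.map (algebraMap ℝ ℂ))) (hσ.cls (b.map (algebraMap ℝ ℂ))) =
      ((∫ x, b.eval x * a.eval x ∂σ : ℝ) : ℂ) := by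
  rw [hσ.inner_cls, ← integral_complex_ofReal]
  refine integral_congr_ae (Filter.Eventually.of_forall fun x => ?_)
  simp only [eval_map_ofReal, Complex.conj_ofReal, Complex.ofReal_mul]

theorem Admissible.cls_injective (hσ : Admissible σ) : Function.Injective hσ.cls := by
  rw [injective_iff_map_eq_zero]
  intro p hp
  by_contra h
  have h1 := hσ.pos p h
  have h2 : (fun x : ℝ => ‖p.eval (x : ℂ)‖ ^ 2) =ᵐ[σ] 0 := by
    filter_upwards [hσ.coeFn_cls p, (Lp.coeFn_zero ℂ 2 σ)] with x h3 h4
    rw [← h3, hp, h4]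
    simp
  rw [integral_congr_ae h2] at h1
  simp at h1

/-- The identification of polynomials with their classes. -/
def Admissible.polyEquiv (hσ : Admissible σ) : ℂ[X] ≃ₗ[ℂ] hσ.polys :=
  LinearEquiv.ofInjective hσ.cls hσ.cls_injective

theorem Admissible.polyEquiv_apply (hσ : Admissible σ) (p : ℂ[X]) :
    hσ.polyEquiv p = hσ.toPolys p := rfl

theorem Admissible.mulX_toPolys (hσ : Admissible σ) (p : ℂ[X]) :
    hσ.mulX (hσ.toPolys p) = hσ.toPolys (X * p) :=
  Subtype.ext (MemLp.toLp_congr (hσ.mul_memLp (hσ.toPolys p)) (hσ.memLp (X * p)) (hσ.mul_ae p))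

/-- An operator on classes of polynomials, acting on the polynomials themselves. -/
def Admissible.pull (hσ : Admissible σ) (𝒜 : Module.End ℂ hσ.polys) : Module.End ℂ ℂ[X] :=
  hσ.polyEquiv.symm.conj 𝒜

theorem Admissible.toPolys_pull (hσ : Admissible σ) (𝒜 : Module.End ℂ hσ.polys) (p : ℂ[X]) :
    hσ.toPolys (hσ.pull 𝒜 p) = 𝒜 (hσ.toPolys p) :=
  hσ.polyEquiv.apply_symm_apply (𝒜 (hσ.toPolys p))

theorem Admissible.toPolys_injective (hσ : Admissible σ) : Function.Injective hσ.toPolys :=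
  hσ.polyEquiv.injective

theorem Admissible.aeval_toPolys (hσ : Admissible σ) (𝒜 : Module.End ℂ hσ.polys) (u w : ℂ[X]) :
    aeval 𝒜 u (hσ.toPolys w) = hσ.toPolys (aeval (hσ.pull 𝒜) u w) := by
  induction u using Polynomial.induction_on generalizing w with
  | C a => simp only [aeval_C, Module.algebraMap_end_apply, map_smul]
  | add p q hp hq => simp only [map_add, LinearMap.add_apply, hp, hq]
  | monomial n a ih =>
    rw [pow_succ, ← mul_assoc, map_mul _ _ X, map_mul _ _ X, Module.End.mul_apply,
      Module.End.mul_apply, aeval_X, aeval_X, ← hσ.toPolys_pull, ih]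

theorem represents_iff (hσ : Admissible σ) (𝒜 : Module.End ℂ hσ.polys)
    (S : ℂ[X] →ₗ[ℂ] ℂ[X] →ₗ⋆[ℂ] ℂ) :
    Represents hσ 𝒜 S ↔ ∀ u v, S u v =
      inner ℂ (hσ.cls (aeval (hσ.pull 𝒜) v 1)) (hσ.cls (aeval (hσ.pull 𝒜) u 1)) := by
  have h : ∀ f g : Lp ℂ 2 σ, ∫ x, f x * conj (g x) ∂σ = inner ℂ g f := fun f g => by
    rw [L2.inner_def]
    simp only [RCLike.inner_apply]
  simp only [Represents, h, hσ.aeval_toPolys]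
  rfl

theorem isExpansion_iff (hσ : Admissible σ) (𝒜 : Module.End ℂ hσ.polys) (ξ : ℕ → ℕ → ℝ) :
    IsExpansion hσ 𝒜 ξ ↔ ∀ k, 0 < ξ k (k + 1) ∧
      hσ.pull 𝒜 (X ^ k) = ∑ j ∈ Finset.range (k + 2), ξ k j • X ^ j := by
  refine forall_congr' fun k => and_congr_right fun _ => ?_
  rw [← hσ.toPolys_pull, hσ.toPolys_injective.eq_iff, Finset.sum_range_succ _ (k + 1), add_comm]
  have h : ∀ (a : ℝ) (p : ℂ[X]), C (a : ℂ) * p = a • p := fun a p => by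
    rw [← smul_eq_C_mul]
    exact algebraMap_smul ℂ a p
  simp only [h]

theorem IsExpansion.isPosReal {hσ : Admissible σ} {𝒜 : Module.End ℂ hσ.polys} {ξ : ℕ → ℕ → ℝ}
    (h : IsExpansion hσ 𝒜 ξ) (k : ℕ) : IsPosReal (k + 1) (hσ.pull 𝒜 (X ^ k)) := by
  obtain ⟨hk, he⟩ := (isExpansion_iff hσ 𝒜 ξ).1 h k
  rw [he]
  exact isPosReal_sum_X_pow hk

theorem exists_isExpansion (hσ : Admissible σ) (𝒜 : Module.End ℂ hσ.polys)
    (h : ∀ k, IsPosReal (k + 1) (hσ.pull 𝒜 (X ^ k))) : ∃ ξ, IsExpansion hσ 𝒜 ξ := by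
  choose ξ h0 _ h2 using fun k => (h k).exists_sum isPosReal_X_pow
  exact ⟨ξ, (isExpansion_iff hσ 𝒜 ξ).2 fun k => ⟨h0 k, h2 k⟩⟩

theorem isSymmetric_iff (hσ : Admissible σ) (𝒜 : Module.End ℂ hσ.polys) :
    (𝒜 ∘ₗ hσ.mulX).IsSymmetric ↔ ∀ u v,
      inner ℂ (hσ.cls (hσ.pull 𝒜 (X * u))) (hσ.cls v) =
        inner ℂ (hσ.cls u) (hσ.cls (hσ.pull 𝒜 (X * v))) := by
  have h : ∀ p, (𝒜 ∘ₗ hσ.mulX) (hσ.toPolys p) = hσ.toPolys (hσ.pull 𝒜 (X * p)) := fun p => by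
    rw [LinearMap.comp_apply, hσ.mulX_toPolys, hσ.toPolys_pull]
  constructor
  · intro hs u v
    have := hs (hσ.toPolys u) (hσ.toPolys v)
    rwa [h, h] at this
  · intro hs f g
    obtain ⟨u, rfl⟩ := hσ.polyEquiv.surjective f
    obtain ⟨v, rfl⟩ := hσ.polyEquiv.surjective g
    rw [hσ.polyEquiv_apply, hσ.polyEquiv_apply, h, h]
    exact hs u v

/-! ### Orthonormal polynomials of an admissible measure. -/

theorem Admissible.integrable_eval (hσ : Admissible σ) (p : ℝ[X]) :
    Integrable (fun x => p.eval x) σ := by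
  induction p using Polynomial.induction_on' with
  | add p q hp hq =>
    simp only [eval_add]
    exact hp.add hq
  | monomial n a => simpa using (hσ.moments n).const_mul a

/-- The `L²_σ` scalar product on real polynomials. -/
@[reducible]
def Admissible.core (hσ : Admissible σ) : InnerProductSpace.Core ℝ ℝ[X] where
  inner p q := ∫ x, p.eval x * q.eval x ∂σ
  conj_inner_symm p q := by simp [mul_comm]
  re_inner_nonneg p := integral_nonneg fun x => mul_self_nonneg _
  add_left p q s := by
    simp only [eval_add, add_mul]
    have h : ∀ p q : ℝ[X], Integrable (fun x => p.eval x * q.eval x) σ := fun p q => by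
      simpa using hσ.integrable_eval (p * q)
    exact integral_add (h p s) (h q s)
  smul_left p q c := by
    simp only [eval_smul, smul_eq_mul, mul_assoc, integral_const_mul]
    simp
  definite p hp := by
    by_contra h
    have := hσ.pos (p.map (algebraMap ℝ ℂ)) fun h' =>
      h ((Polynomial.map_eq_zero _).1 h')
    simp only [eval_map_ofReal, Complex.norm_real, Real.norm_eq_abs, sq_abs] at this
    simp only [sq] at this
    exact this.ne' hp

theorem linearIndependent_X_pow : LinearIndependent ℝ (fun n : ℕ => (X ^ n : ℝ[X])) := by
  have := (basisMonomials ℝ).linearIndependent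
  simpa [Polynomial.coe_basisMonomials, ← X_pow_eq_monomial] using this

/-- Gram–Schmidt applied to the monomials for the scalar product `Admissible.core`; each step
subtracts only lower powers, so leading coefficients stay positive. -/
theorem exists_isOrthonormalSystem (hσ : Admissible σ) :
    ∃ r : ℕ → ℝ[X], IsOrthonormalSystem σ r ∧ ∀ n, IsPosReal n (r n) := by
  let _ : NormedAddCommGroup ℝ[X] := @InnerProductSpace.Core.toNormedAddCommGroup ℝ _ _ _ _ hσ.core
  let _ : InnerProductSpace ℝ ℝ[X] := InnerProductSpace.ofCore hσ.core.toCore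
  have hinner : ∀ p q : ℝ[X], inner ℝ p q = ∫ x, p.eval x * q.eval x ∂σ := fun _ _ => rfl
  let f : ℕ → ℝ[X] := fun n => X ^ n
  have hne := fun n =>
    InnerProductSpace.gramSchmidt_ne_zero (𝕜 := ℝ) (f := f) n linearIndependent_X_pow
  have hpos : ∀ n, IsPosReal n (InnerProductSpace.gramSchmidtNormed ℝ f n) := by
    intro n
    rw [InnerProductSpace.gramSchmidtNormed]
    refine IsPosReal.smul ?_ (inv_pos.2 (norm_pos_iff.2 (hne n)))
    refine ⟨1, one_pos, ?_⟩
    rw [one_smul, InnerProductSpace.gramSchmidt_def, sub_sub_cancel_left]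
    refine neg_mem (Submodule.sum_mem _ fun i hi => ?_)
    have h1 := Submodule.starProjection_apply_mem
      (Submodule.span ℝ {InnerProductSpace.gramSchmidt ℝ f i}) (f n)
    rw [realLT, ← InnerProductSpace.span_gramSchmidt_Iio ℝ f n]
    refine Submodule.span_mono ?_ h1
    rintro _ rfl
    exact ⟨i, Finset.mem_Iio.1 hi, rfl⟩
  refine ⟨InnerProductSpace.gramSchmidtNormed ℝ f, ⟨fun n => ?_, fun n => ?_, fun n m => ?_⟩, hpos⟩
  · exact natDegree_eq_of_degree_eq_some (hpos n).degree_eq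
  · obtain ⟨-, a, ha, h⟩ := (hpos n).degree_eq_and_leadingCoeff
    rw [h]
    exact ha
  · rw [← hinner]
    exact orthonormal_iff_ite.1
      (InnerProductSpace.gramSchmidtNormed_orthonormal linearIndependent_X_pow) n m

/-! ### From the measure and the operator to the pencil. -/

theorem C_ofReal_mul (a : ℝ) (p : ℂ[X]) : C (a : ℂ) * p = a • p := by
  rw [← smul_eq_C_mul]
  exact algebraMap_smul ℂ a p

theorem Admissible.inner_sum (hσ : Admissible σ) {R : ℕ → ℂ[X]}
    (hR : ∀ n m, inner ℂ (hσ.cls (R n)) (hσ.cls (R m)) = if n = m then 1 else 0) {N : ℕ}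
    {c : ℕ → ℝ} (hc : ∀ k, N ≤ k → c k = 0) (m : ℕ) :
    inner ℂ (hσ.cls (R m)) (hσ.cls (∑ k ∈ Finset.range N, c k • R k)) = (c m : ℂ) := by
  simp only [← C_ofReal_mul, ← smul_eq_C_mul, map_sum, map_smul, _root_.inner_sum,
    inner_smul_right, hR, mul_ite, mul_one, mul_zero, Finset.sum_ite_eq, Finset.mem_range]
  split_ifs with h
  · rfl
  · rw [hc m (not_lt.1 h), Complex.ofReal_zero]

/-- The map `u ↦ u(𝒜)(1)` on polynomials is a linear automorphism that preserves triangularity. -/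
theorem exists_linearEquiv_aeval {B : Module.End ℂ ℂ[X]}
    (hB : ∀ k, IsPosReal (k + 1) (B (X ^ k))) :
    ∃ e : ℂ[X] ≃ₗ[ℂ] ℂ[X], ∀ u, e u = aeval B u 1 := by
  have hT : ∀ n, IsPosReal n (aeval B (X ^ n : ℂ[X]) (1 : ℂ[X])) := by
    intro n
    induction n with
    | zero => simpa using isPosReal_zero_one
    | succ n ih =>
      rw [pow_succ', map_mul, Module.End.mul_apply, aeval_X]
      exact ih.map isPosReal_X_pow hB
  obtain ⟨e, he⟩ := exists_linearEquiv_of_triangular isPosReal_X_pow hT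
  refine ⟨e, fun u => ?_⟩
  have : e.toLinearMap = (LinearMap.applyₗ (1 : ℂ[X])) ∘ₗ (aeval B).toLinearMap := by
    refine (triangularBasis _ isPosReal_X_pow).ext fun n => ?_
    rw [triangularBasis_apply]
    exact he n
  exact LinearMap.congr_fun this u

theorem IsPosReal.exists_eq_C {p : ℝ[X]} (hp : IsPosReal 0 p) : ∃ a : ℝ, 0 < a ∧ p = C a := by
  obtain ⟨a, ha, -, h⟩ := hp.exists_sum isPosReal_X_pow
  exact ⟨a 0, ha, by simpa [smul_eq_C_mul] using h⟩

theorem IsPosReal.exists_eq_linear {p : ℝ[X]} (hp : IsPosReal 1 p) :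
    ∃ a b : ℝ, 0 < a ∧ p = C a * X + C b := by
  obtain ⟨a, ha, -, h⟩ := hp.exists_sum isPosReal_X_pow
  refine ⟨a 1, a 0, ha, ?_⟩
  rw [h, Finset.sum_range_succ, Finset.sum_range_one, pow_zero, pow_one, smul_eq_C_mul,
    smul_eq_C_mul, mul_one, add_comm]

theorem orthonormalSystem_zero {r : ℕ → ℝ[X]} (hσ : Admissible σ) (hr : IsOrthonormalSystem σ r)
    (hpos : ∀ n, IsPosReal n (r n)) : r 0 = 1 := by
  have := hσ.prob
  obtain ⟨a, ha, h⟩ := (hpos 0).exists_eq_C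
  have h1 := hr.orthonormal 0 0
  simp only [h, eval_C, integral_const, probReal_univ, one_smul, if_true] at h1
  have : a = 1 := by nlinarith
  rw [h, this, C_1]

theorem orthonormalSystem_one {r : ℕ → ℝ[X]} (hσ : Admissible σ) (hr : IsOrthonormalSystem σ r)
    (hpos : ∀ n, IsPosReal n (r n)) :
    0 < (∫ x, x ^ 2 ∂σ) - (∫ x, x ∂σ) ^ 2 ∧
    r 1 = C (1 / √((∫ x, x ^ 2 ∂σ) - (∫ x, x ∂σ) ^ 2)) * (X - C (∫ x, x ∂σ)) := by
  have := hσ.prob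
  obtain ⟨a, b, ha, h⟩ := (hpos 1).exists_eq_linear
  have i1 : Integrable (fun x : ℝ => x) σ := by simpa using hσ.moments 1
  have i2 : Integrable (fun x : ℝ => x ^ 2) σ := hσ.moments 2
  set s₁ := ∫ x, x ∂σ
  set s₂ := ∫ x, x ^ 2 ∂σ
  have h0 : a * s₁ + b = 0 := by
    have h1 := hr.orthonormal 1 0
    simp only [orthonormalSystem_zero hσ hr hpos, h, eval_add, eval_mul, eval_C, eval_X, eval_one,
      mul_one, one_ne_zero, if_false] at h1
    rw [integral_add (i1.const_mul a) (integrable_const b), integral_const_mul] at h1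
    simpa using h1
  have hb : b = -(a * s₁) := by linarith
  have hlin : ∀ c d : ℝ, Integrable (fun x => c * x + d) σ := fun c d =>
    (i1.const_mul c).add (integrable_const d)
  have h2 : a ^ 2 * (s₂ - s₁ ^ 2) = 1 := by
    have h1 := hr.orthonormal 1 1
    simp only [h, eval_add, eval_mul, eval_C, eval_X, if_true] at h1
    have hfun : (fun x : ℝ => (a * x + b) * (a * x + b)) =
        fun x => a ^ 2 * x ^ 2 + (2 * a * b * x + b ^ 2) := by funext x; ring
    rw [hfun, integral_add (i2.const_mul _) (hlin (2 * a * b) (b ^ 2)),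
      integral_add (i1.const_mul _) (integrable_const _), integral_const_mul,
      integral_const_mul] at h1
    simp only [integral_const, probReal_univ, one_smul] at h1
    rw [← h1, hb]
    ring
  have hv : 0 < s₂ - s₁ ^ 2 := by
    by_contra hn
    have := mul_nonpos_of_nonneg_of_nonpos (sq_nonneg a) (not_lt.1 hn)
    linarith
  have hav : 1 / √(s₂ - s₁ ^ 2) = a := by
    rw [div_eq_iff (Real.sqrt_pos.2 hv).ne', ← Real.sqrt_sq ha.le, ← Real.sqrt_mul (sq_nonneg a),
      h2, Real.sqrt_one]
  refine ⟨hv, ?_⟩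
  rw [hav, h, hb, C_neg, C_mul]
  ring

theorem exists_reconstructed_pencil {S : ℂ[X] →ₗ[ℂ] ℂ[X] →ₗ⋆[ℂ] ℂ} (hσ : Admissible σ)
    (𝒜 : Module.End ℂ hσ.polys) (hA : IsModelOperator hσ 𝒜) (hS : Represents hσ 𝒜 S) :
    ∃ (ξ : ℕ → ℕ → ℝ) (r : ℕ → ℝ[X]) (Θ : Pencil),
      IsExpansion hσ 𝒜 ξ ∧ IsOrthonormalSystem σ r ∧ IsReconstructed hσ 𝒜 ξ r Θ ∧
        Θ.IsSpectralFunction S := by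
  obtain ⟨ξ, hξ⟩ := hA.expansion
  obtain ⟨r, hr, hrpos⟩ := exists_isOrthonormalSystem hσ
  rw [represents_iff] at hS
  have hsymm := (isSymmetric_iff hσ 𝒜).1 hA.symmetric
  have hexp := hξ.isPosReal
  have hξ0 := (isExpansion_iff hσ 𝒜 ξ).1 hξ 0
  have htoPolys : ∀ p, 𝒜 (hσ.mulX (hσ.toPolys p)) = hσ.toPolys (hσ.pull 𝒜 (X * p)) := fun p => by
    rw [hσ.mulX_toPolys, hσ.toPolys_pull]
  -- All facts about 𝒜 are now stated for its action B on polynomials; the operator on classes is no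
  -- longer needed.
  generalize hσ.pull 𝒜 = B at *
  let R : ℕ → ℂ[X] := fun n => (r n).map (algebraMap ℝ ℂ)
  have hR : ∀ n, IsPosReal n (R n) := fun n => (hrpos n).map_algebraMap
  have hortho : ∀ n m, inner ℂ (hσ.cls (R n)) (hσ.cls (R m)) = if n = m then 1 else 0 := by
    intro n m
    rw [hσ.inner_cls_map, hr.orthonormal]
    simp only [eq_comm]
    split_ifs <;> simp
  choose c₃ hpos₃ hzero₃ hsum₃ using fun n => (hR n).X_mul.exists_sum hR
  -- Multiplication by X and then B each raise the degree by one, so the coefficients end at index n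
  -- + 2. Together with the symmetry `hs₅` this gives five diagonals.
  choose c₅ hpos₅ hzero₅ hsum₅ using fun n =>
    ((hR n).X_mul.map isPosReal_X_pow hexp).exists_sum hR
  have hin₃ : ∀ m n, inner ℂ (hσ.cls (R m)) (hσ.cls (X * R n)) = (c₃ n m : ℂ) := fun m n => by
    rw [hsum₃]
    exact hσ.inner_sum hortho (fun k hk => hzero₃ n k hk) m
  have hin₅ : ∀ m n, inner ℂ (hσ.cls (R m)) (hσ.cls (B (X * R n))) = (c₅ n m : ℂ) := fun m n => by
    rw [hsum₅]
    exact hσ.inner_sum hortho (fun k hk => hzero₅ n k hk) m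
  have hs₃ : ∀ m n, c₃ n m = c₃ m n := fun m n => by
    apply Complex.ofReal_injective
    rw [← hin₃ m n, ← hσ.inner_cls_X_mul, ← inner_conj_symm, hin₃, Complex.conj_ofReal]
  have hs₅ : ∀ m n, c₅ n m = c₅ m n := fun m n => by
    apply Complex.ofReal_injective
    rw [← hin₅ m n, ← hsymm, ← inner_conj_symm, hin₅, Complex.conj_ofReal]
  obtain ⟨hv, hr1⟩ := orthonormalSystem_one hσ hr hrpos
  have hr0 := orthonormalSystem_zero hσ hr hrpos
  have hsqrt := Real.sqrt_pos.2 hv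
  have hξ01 : 0 < ξ 0 1 := hξ0.1
  let Θ : Pencil :=
    { J₃ := fun m n => c₃ n m
      J₅ := fun m n => c₅ n m
      α := 1 / (ξ 0 1 * √((∫ x, x ^ 2 ∂σ) - (∫ x, x ∂σ) ^ 2))
      β := -(ξ 0 1 * (∫ x, x ∂σ) + ξ 0 0) / (ξ 0 1 * √((∫ x, x ^ 2 ∂σ) - (∫ x, x ∂σ) ^ 2))
      J₃_symm := by ext m n; exact hs₃ n m
      J₃_tridiagonal := fun m n h => hzero₃ n m h
      J₃_pos := hpos₃
      J₅_symm := by ext m n; exact hs₅ n m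
      J₅_fiveDiagonal := fun m n h => hzero₅ n m h
      J₅_pos := hpos₅
      α_pos := by positivity }
  refine ⟨ξ, r, Θ, hξ, hr, ⟨fun n => ?_, fun m n => ?_, rfl, rfl⟩, ?_⟩
  · apply Polynomial.map_injective _ (algebraMap ℝ ℂ).injective
    rw [Polynomial.map_sum, Polynomial.map_mul, map_X]
    refine Eq.trans (Finset.sum_congr rfl fun m _ => ?_) (hsum₃ n).symm
    rw [Polynomial.map_mul, map_C, hs₃ m n]
    exact C_ofReal_mul _ _
  · rw [htoPolys]
    exact (hin₅ m n).symm
  · obtain ⟨e, he⟩ := exists_linearEquiv_aeval hexp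
    have heX : ∀ u, e (X * u) = B (e u) := fun u => by
      rw [he, he, map_mul, Module.End.mul_apply, aeval_X]
    have he1 : e 1 = 1 := by rw [he]; simp
    have hesmul : ∀ (a : ℝ) u, e (a • u) = a • e u := fun a u => by
      rw [← C_ofReal_mul, ← smul_eq_C_mul, map_smul, smul_eq_C_mul, C_ofReal_mul]
    refine ⟨fun n => e.symm (R n), ⟨?_, ?_, fun n => ?_⟩, fun n m => ?_⟩
    · rw [e.symm_apply_eq, he1]
      simp [R, hr0]
    -- The values of α and β are those solving α(ξ₀₁ x + ξ₀₀) + β = r₁ = (x - s₁) / √(s₂ - s₁²).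
    · rw [e.symm_apply_eq, C_ofReal_mul, ← mul_one (C (Θ.β : ℂ)), C_ofReal_mul, map_add, hesmul,
        hesmul, he1, ← mul_one (X : ℂ[X]), heX, he1, ← pow_zero (X : ℂ[X]), hξ0.2]
      have hα : Θ.α * ξ 0 1 = 1 / √((∫ x, x ^ 2 ∂σ) - (∫ x, x ∂σ) ^ 2) := by
        simp only [Θ]
        field_simp
      have hβ : Θ.α * ξ 0 0 + Θ.β =
          -(1 / √((∫ x, x ^ 2 ∂σ) - (∫ x, x ∂σ) ^ 2) * ∫ x, x ∂σ) := by
        simp only [Θ]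
        field_simp
        ring
      simp only [Finset.sum_range_succ, Finset.sum_range_zero, zero_add, pow_zero, pow_one, smul_add,
        smul_smul, hα]
      rw [add_right_comm, ← add_smul, hβ]
      simp only [R, hr1, ← C_ofReal_mul, Polynomial.map_mul, Polynomial.map_sub, map_C, map_X,
        mul_one, Complex.coe_algebraMap, Complex.ofReal_neg, Complex.ofReal_mul, C_neg, C_mul]
      ring
    · apply e.injective
      have hterm : ∀ m, e ((C (Θ.J₅ n m : ℂ) - X * C (Θ.J₃ n m : ℂ)) * e.symm (R m)) =
          c₅ n m • R m - B (c₃ n m • R m) := fun m => by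
        rw [sub_mul, mul_assoc, C_ofReal_mul, C_ofReal_mul, map_sub, heX, hesmul, hesmul,
          e.apply_symm_apply]
        simp only [Θ, hs₃ m n, hs₅ m n]
      rw [map_zero, map_sum]
      simp only [hterm]
      -- After e, the row reads B(X rₙ) - B(∑ c₃ rₘ); the J₃ sum has a zero last term, so it equals
      -- X rₙ.
      rw [Finset.sum_sub_distrib, ← map_sum, ← hsum₅, Finset.sum_range_succ _ (n + 2),
        hzero₃ n (n + 2) (by omega), zero_smul, add_zero, ← hsum₃, sub_self]
    · rw [hS, ← he, ← he, e.apply_symm_apply, e.apply_symm_apply, hortho]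
      simp only [eq_comm]

/-! ### From the pencil to the measure and the operator. -/

/-- Row n can be solved for the polynomial of index n + 2, because the outer entry of J₅ is
positive. The only term of degree n + 2 on the other side is λ times the previous polynomial, with a
positive entry of J₃ as coefficient. -/
theorem Pencil.IsAssociated.isPosReal {Θ : Pencil} {p : ℕ → ℂ[X]} (hp : Θ.IsAssociated p) (n : ℕ) :
    IsPosReal n (p n) := by
  induction n using Nat.strong_induction_on with
  | _ n ih =>
  match n, ih with
  | 0, _ => rw [hp.zero]; exact isPosReal_zero_one
  | 1, _ =>
    rw [hp.one, C_ofReal_mul, ← mul_one (C (Θ.β : ℂ)), C_ofReal_mul]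
    have h1 : IsPosReal 1 (X : ℂ[X]) := by simpa using isPosReal_X_pow (K := ℂ) 1
    exact (h1.smul Θ.α_pos).add_mem (Submodule.smul_mem _ _ isPosReal_zero_one.mem)
  | n + 2, ih =>
    have hrow := hp.row n
    have hterm : ∀ m, (C (Θ.J₅ n m : ℂ) - X * C (Θ.J₃ n m : ℂ)) * p m =
        Θ.J₅ n m • p m - Θ.J₃ n m • (X * p m) := fun m => by
      rw [sub_mul, mul_assoc, C_ofReal_mul, C_ofReal_mul, mul_smul_comm]
    simp only [hterm] at hrow
    rw [Finset.sum_range_succ, Finset.sum_range_succ, ← Θ.J₃_symm.apply n (n + 2),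
      Θ.J₃_tridiagonal (n + 2) n (by omega), zero_smul, sub_zero, ← Θ.J₃_symm.apply n (n + 1),
      ← Θ.J₅_symm.apply n (n + 2)] at hrow
    have hrest : ∑ m ∈ Finset.range (n + 1), (Θ.J₅ n m • p m - Θ.J₃ n m • (X * p m)) ∈
        realLT ℂ (n + 2) := by
      refine Submodule.sum_mem _ fun m hm => ?_
      have hm' := Finset.mem_range.1 hm
      have hpm := ih m (by omega)
      exact sub_mem (Submodule.smul_mem _ _ (hpm.mem_of_lt (by omega)))
        (Submodule.smul_mem _ _ (hpm.X_mul.mem_of_lt (by omega)))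
    have hn1 := ih (n + 1) (by omega)
    have hkey : Θ.J₅ (n + 2) n • p (n + 2) = Θ.J₃ (n + 1) n • (X * p (n + 1)) +
        (-(∑ m ∈ Finset.range (n + 1), (Θ.J₅ n m • p m - Θ.J₃ n m • (X * p m))) +
          (-(Θ.J₅ n (n + 1))) • p (n + 1)) := by
      rw [← sub_eq_zero, ← hrow, neg_smul]
      abel
    have hpos := ((hn1.X_mul.smul (Θ.J₃_pos n)).add_mem (add_mem (neg_mem hrest)
      (Submodule.smul_mem _ (-(Θ.J₅ n (n + 1))) hn1.mem)))
    rw [← hkey] at hpos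
    have := hpos.smul (inv_pos.2 (Θ.J₅_pos n))
    rwa [inv_smul_smul₀ (Θ.J₅_pos n).ne'] at this

/-- The sesquilinear form `(M u, N v)` of `L²_σ` on polynomials. -/
def Admissible.form (hσ : Admissible σ) (M N : Module.End ℂ ℂ[X]) :
    ℂ[X] →ₗ[ℂ] ℂ[X] →ₗ⋆[ℂ] ℂ :=
  LinearMap.mk₂'ₛₗ (RingHom.id ℂ) (starRingEnd ℂ)
    (fun u v => inner ℂ (hσ.cls (N v)) (hσ.cls (M u)))
    (fun u u' v => by simp only [map_add, inner_add_right])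
    (fun c u v => by simp only [map_smul, inner_smul_right, RingHom.id_apply, smul_eq_mul])
    (fun u v v' => by simp only [map_add, inner_add_left])
    (fun c u v => by simp only [map_smul, inner_smul_left, smul_eq_mul])

theorem Admissible.form_apply (hσ : Admissible σ) (M N : Module.End ℂ ℂ[X]) (u v : ℂ[X]) :
    hσ.form M N u v = inner ℂ (hσ.cls (N v)) (hσ.cls (M u)) := rfl

theorem sesquilinear_ext_of_triangular {S S' : ℂ[X] →ₗ[ℂ] ℂ[X] →ₗ⋆[ℂ] ℂ} {p : ℕ → ℂ[X]}
    (hp : ∀ n, IsPosReal n (p n)) (h : ∀ n m, S (p n) (p m) = S' (p n) (p m)) : S = S' := by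
  refine (triangularBasis p hp).ext fun n => (triangularBasis p hp).ext fun m => ?_
  rw [triangularBasis_apply, triangularBasis_apply]
  exact h n m

theorem exists_model_of_isSpectralFunction {S : ℂ[X] →ₗ[ℂ] ℂ[X] →ₗ⋆[ℂ] ℂ} (Θ : Pencil)
    (hΘ : Θ.IsSpectralFunction S) :
    ∃ (σ : Measure ℝ) (hσ : Admissible σ) (𝒜 : Module.End ℂ hσ.polys),
      IsModelOperator hσ 𝒜 ∧ Represents hσ 𝒜 S := by
  obtain ⟨p, hp, hSp⟩ := hΘ
  obtain ⟨σ, hσ, horth⟩ := exists_admissible_of_jacobi Θ.J₃_symm Θ.J₃_tridiagonal Θ.J₃_pos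
  let R : ℕ → ℂ[X] := fun n => (recurrencePoly Θ.J₃ n).map (algebraMap ℝ ℂ)
  have hR : ∀ n, IsPosReal n (R n) := fun n =>
    (isPosReal_recurrencePoly Θ.J₃_pos n).map_algebraMap
  have hortho : ∀ n m, inner ℂ (hσ.cls (R n)) (hσ.cls (R m)) = if n = m then 1 else 0 := by
    intro n m
    rw [hσ.inner_cls_map, horth]
    simp only [eq_comm]
    split_ifs <;> simp
  -- The extra zero term gives the sum the same range as a row of the pencil.
  have hXR : ∀ n, X * R n = ∑ m ∈ Finset.range (n + 3), Θ.J₃ n m • R m := by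
    intro n
    have := congrArg (Polynomial.map (algebraMap ℝ ℂ))
      (sum_smul_recurrencePoly Θ.J₃_symm Θ.J₃_tridiagonal Θ.J₃_pos n)
    rw [Polynomial.map_mul, map_X, Polynomial.map_sum] at this
    rw [Finset.sum_range_succ, ← Θ.J₃_symm.apply n (n + 2),
      Θ.J₃_tridiagonal (n + 2) n (by omega), zero_smul, add_zero, ← this]
    refine Finset.sum_congr rfl fun m _ => ?_
    rw [smul_eq_C_mul, Polynomial.map_mul, map_C]
    exact C_ofReal_mul _ _
  obtain ⟨e, he⟩ := exists_linearEquiv_of_triangular hp.isPosReal hR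
  have hesmul : ∀ (a : ℝ) u, e (a • u) = a • e u := fun a u => by
    rw [← C_ofReal_mul, ← smul_eq_C_mul, map_smul, smul_eq_C_mul, C_ofReal_mul]
  let B : Module.End ℂ ℂ[X] := e.conj (LinearMap.mulLeft ℂ X)
  have hBe : ∀ u, B (e u) = e (X * u) := fun u => by
    simp [B, LinearEquiv.conj_apply]
  have he1 : e 1 = 1 := by
    have := he 0
    rw [hp.zero] at this
    rw [this]
    simp [R, recurrencePoly]
  have haeval : ∀ u, aeval B u 1 = e u := by
    intro u
    -- The induction on u needs arbitrary w; the case w = 1 is the one wanted.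
    have hu : ∀ w, aeval B u (e w) = e (u * w) := by
      induction u using Polynomial.induction_on with
      | C a => intro w; rw [aeval_C, Module.algebraMap_end_apply, ← smul_eq_C_mul, map_smul]
      | add p q hp hq => intro w; rw [map_add, LinearMap.add_apply, hp, hq, add_mul, map_add]
      | monomial n a ih =>
        intro w
        rw [pow_succ, ← mul_assoc, map_mul _ _ X, Module.End.mul_apply, aeval_X, hBe, ih,
          mul_assoc _ X w]
    have := hu 1
    rwa [he1, mul_one] at this
  have hBX : ∀ n, B (X * R n) = ∑ m ∈ Finset.range (n + 3), Θ.J₅ n m • R m := by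
    intro n
    have h1 : X * R n = e (∑ m ∈ Finset.range (n + 3), Θ.J₃ n m • p m) := by
      rw [hXR, map_sum]
      simp only [hesmul, he]
    -- The pencil equation itself; transported by e it identifies J₅ with the matrix of B after
    -- multiplication by X.
    have h2 : X * ∑ m ∈ Finset.range (n + 3), Θ.J₃ n m • p m =
        ∑ m ∈ Finset.range (n + 3), Θ.J₅ n m • p m := by
      rw [← sub_eq_zero, ← neg_eq_zero, ← hp.row n, Finset.mul_sum, neg_sub,
        ← Finset.sum_sub_distrib]
      refine Finset.sum_congr rfl fun m _ => ?_
      rw [sub_mul, mul_assoc, C_ofReal_mul, C_ofReal_mul]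
    rw [h1, hBe, h2, map_sum]
    simp only [hesmul, he]
  let 𝒜 : Module.End ℂ hσ.polys := hσ.polyEquiv.conj B
  have hpull : hσ.pull 𝒜 = B := by
    refine LinearMap.ext fun u => ?_
    simp [Admissible.pull, 𝒜, LinearEquiv.conj_apply]
  refine ⟨σ, hσ, 𝒜, ⟨exists_isExpansion hσ 𝒜 fun k => ?_, (isSymmetric_iff hσ 𝒜).2 ?_⟩,
    (represents_iff hσ 𝒜 S).2 fun u v => ?_⟩
  · rw [hpull]
    -- It suffices to test on the orthonormal system, where B rₙ = e(X pₙ) and e preserves degree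
    -- and sign.
    refine (isPosReal_X_pow k).map hR (d := 1) fun n => ?_
    rw [← he, hBe]
    have : ∀ {n q}, IsPosReal n q → IsPosReal n (e q) := fun {n q} hq =>
      hq.map (d := 0) (B := e.toLinearMap) hp.isPosReal fun n => by
        simpa [he] using hR n
    exact this (hp.isPosReal n).X_mul
  · rw [hpull]
    have hin : ∀ m n, inner ℂ (hσ.cls (R m)) (hσ.cls (B (X * R n))) = (Θ.J₅ n m : ℂ) :=
      fun m n => by
        rw [hBX]
        refine hσ.inner_sum hortho (fun k hk => ?_) m
        rw [← Θ.J₅_symm.apply, Θ.J₅_fiveDiagonal k n (by omega)]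
    -- Symmetry is an equality of sesquilinear forms, so it can be checked on the basis, where it is
    -- the symmetry of the real matrix J₅.
    have hform : hσ.form 1 (B ∘ₗ LinearMap.mulLeft ℂ X) =
        hσ.form (B ∘ₗ LinearMap.mulLeft ℂ X) 1 := by
      refine sesquilinear_ext_of_triangular hR fun n m => ?_
      simp only [hσ.form_apply, LinearMap.comp_apply, LinearMap.mulLeft_apply,
        Module.End.one_apply]
      rw [← inner_conj_symm, hin, hin, Complex.conj_ofReal, Θ.J₅_symm.apply]
    intro u v
    exact LinearMap.congr_fun (LinearMap.congr_fun hform v) u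
  · rw [hpull, haeval, haeval]
    have hform : S = hσ.form e.toLinearMap e.toLinearMap := by
      refine sesquilinear_ext_of_triangular hp.isPosReal fun n m => ?_
      rw [hSp, hσ.form_apply, LinearEquiv.coe_coe, he, he, hortho]
      simp only [eq_comm]
    rw [hform]
    rfl

end JacobiPencil

end

open MeasureTheory Polynomial ComplexConjugate JacobiPencil in
theorem theorem3p1 (S : ℂ[X] →ₗ[ℂ] ℂ[X] →ₗ⋆[ℂ] ℂ)
    (hS_herm : ∀ u v : ℂ[X], conj (S u v) = S v u)
    (hS_nonneg : ∀ u : ℂ[X], 0 ≤ (S u u).re) :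
    ((∃ Θ : Pencil, Θ.IsSpectralFunction S) ↔
      ∃ (σ : Measure ℝ) (hσ : Admissible σ) (𝒜 : Module.End ℂ hσ.polys),
        IsModelOperator hσ 𝒜 ∧ Represents hσ 𝒜 S) ∧
    (∀ (σ : Measure ℝ) (hσ : Admissible σ) (𝒜 : Module.End ℂ hσ.polys),
      IsModelOperator hσ 𝒜 → Represents hσ 𝒜 S →
        ∃ (ξ : ℕ → ℕ → ℝ) (r : ℕ → ℝ[X]) (Θ : Pencil),
          IsExpansion hσ 𝒜 ξ ∧ IsOrthonormalSystem σ r ∧ IsReconstructed hσ 𝒜 ξ r Θ ∧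
            Θ.IsSpectralFunction S) := by
  have key : ∀ (σ : Measure ℝ) (hσ : Admissible σ) (𝒜 : Module.End ℂ hσ.polys),
      IsModelOperator hσ 𝒜 → Represents hσ 𝒜 S →
        ∃ (ξ : ℕ → ℕ → ℝ) (r : ℕ → ℝ[X]) (Θ : Pencil),
          IsExpansion hσ 𝒜 ξ ∧ IsOrthonormalSystem σ r ∧ IsReconstructed hσ 𝒜 ξ r Θ ∧
            Θ.IsSpectralFunction S :=
    fun σ hσ 𝒜 hA hS => exists_reconstructed_pencil hσ 𝒜 hA hS
  refine ⟨⟨fun ⟨Θ, hΘ⟩ => exists_model_of_isSpectralFunction Θ hΘ, ?_⟩, key⟩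
  rintro ⟨σ, hσ, 𝒜, hA, hS⟩
  obtain ⟨_, _, Θ, _, _, _, hΘ⟩ := key σ hσ 𝒜 hA hS
  exact ⟨Θ, hΘ⟩
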